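/- Let $n\geq 1$ and let $x_1,\dots,x_n>0$ be real numbers. Put $\zeta(z)=e^{z/2}-e^{-z/2}$, $P_1(a_1;x_1)=1/x_1$, and for $n\geq 2$ $$P_n(a_1,\dots,a_n;x_1,\dots,x_n)=\sum_{\substack{\tau\in S_n\\ \tau(1)=1}}\frac{\prod_{j=2}^{n-1}x_{\tau(j)}\ \prod_{j=1}^{n-1}\zeta\Big(\big(\sum_{k=1}^{j}a_{\tau(k)}\big)x_{\tau(j+1)}-a_{\tau(j+1)}\big(\sum_{k=1}^{j}x_{\tau(k)}\big)\Big)}{\prod_{j=1}^{n-1}\big(a_{\tau(j)}x_{\tau(j+1)}-a_{\tau(j+1)}x_{\tau(j)}\big)} .$$ Define, with $\mathsf i=\sqrt{-1}$, $$\mathcal F_n^{\mathsf{Bur}}(x_1,\dots,x_n)=\frac{e^{(\sum_{j=1}^n x_j)^3/24}}{\big(\sum_{j=1}^n x_j\big)\prod_{j=1}^n\sqrt{2\pi x_j}}\int_{\mathbb R^n}\Big[\prod_{j=1}^n e^{-\frac{a_j^2}{2x_j}}\,da_j\Big]\,P_n(\mathsf i a_1,\dots,\mathsf i a_n;x_1,\dots,x_n).$$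 For $\ell\geq 1$ and $y_1,\dots,y_\ell>0$ define, with $s_{\ell+1}=s_1$, $$\mathcal E(y_1,\dots,y_\ell)=\frac{e^{(\sum_{j=1}^\ell y_j^3)/12}}{\prod_{j=1}^\ell\sqrt{4\pi y_j}}\int_{\mathbb R_{\geq 0}^\ell}\exp\Big(-\sum_{j=1}^\ell\Big(\frac{(s_j-s_{j+1})^2}{4y_j}+\frac{(s_j+s_{j+1})y_j}{2}\Big)\Big)\,ds_1\cdots ds_\ell ,$$ $$\mathcal E^{\circlearrowleft}(y_1,\dots,y_\ell)=\sum_{\sigma\in S_\ell/\mathbb Z_\ell}\mathcal E(y_{\sigma(1)},\dots,y_{\sigma(\ell)}),$$ where $\mathbb Z_\ell\subset S_\ell$ is generated by the cyclic rotation $j\mapsto j+1$ (the summand depends only on the class $\sigma\mathbb Z_\ell$, and $\mathcal E^{\circlearrowleft}$ is symmetric). Further let $$\mathcal G(y_1,\dots,y_n)=\sum_{\{I_1,\dots,I_\ell\}}(-1)^{\ell+1}\,\mathcal E^{\circlearrowleft}\Big(\sum_{i\in I_1}y_i,\dots,\sum_{i\in I_\ell}y_i\Big),$$ the sum being over all partitions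 of $\{1,\dots,n\}$ into nonempty disjoint subsets $I_1,\dots,I_\ell$, $1\leq\ell\leq n$, and $$\mathcal F_n^{\mathsf{Ok}}(x_1,\dots,x_n)=\frac{(2\pi)^{n/2}}{\prod_{j=1}^n\sqrt{x_j}}\ \mathcal G\Big(\frac{x_1}{2^{1/3}},\dots,\frac{x_n}{2^{1/3}}\Big).$$ Then all the integrals above converge absolutely, and $$\mathcal F_n^{\mathsf{Bur}}(x_1,\dots,x_n)=\mathcal F_n^{\mathsf{Ok}}(x_1,\dots,x_n).$$ -/

import Mathlib

open MeasureTheory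

noncomputable section

/-- `ζ(z) = e^{z/2} - e^{-z/2}`. -/
def zetaFn (z : ℂ) : ℂ := Complex.exp (z / 2) - Complex.exp (-(z / 2))

/-- Buryak's function `P_n(a; x)`. The index `j = 1, …, n` is represented by `Fin n`, starting from
`0`. For `n = m + 2` the products over `j = 1, …, n - 1` run over `Fin (m + 1)`, where `j.castSucc`
and `j.succ` are the positions `j` and `j + 1`, and the product over `j = 2, …, n - 1` runs over
`Fin m`. The value at `n = 0` is a placeholder. On the null set where a denominator vanishes, the
corresponding summand is `0` by convention; this does not affect integrals. -/
def buryakP : (n : ℕ) → (Fin n → ℂ) → (Fin n → ℂ) → ℂ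
  | 0, _, _ => 0
  | 1, _, x => 1 / x 0
  | m + 2, a, x =>
    ∑ τ : Equiv.Perm (Fin (m + 2)) with τ 0 = 0,
      ((∏ j : Fin m, x (τ j.castSucc.succ)) *
        ∏ j : Fin (m + 1),
          zetaFn ((∑ k ∈ Finset.Iic j.castSucc, a (τ k)) * x (τ j.succ)
            - a (τ j.succ) * ∑ k ∈ Finset.Iic j.castSucc, x (τ k))) /
        ∏ j : Fin (m + 1),
          (a (τ j.castSucc) * x (τ j.succ) - a (τ j.succ) * x (τ j.castSucc))

/-- The integrand `∏ⱼ e^{-aⱼ²/(2xⱼ)} · P_n(i a; x)` of Buryak's Gaussian integral. -/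
def buryakIntegrand (n : ℕ) (x a : Fin n → ℝ) : ℂ :=
  ((∏ j, Real.exp (-(a j ^ 2 / (2 * x j))) : ℝ) : ℂ) *
    buryakP n (fun j => Complex.I * (a j : ℂ)) (fun j => (x j : ℂ))

/-- Buryak's formula for the `n`-point function. -/
def buryakF (n : ℕ) (x : Fin n → ℝ) : ℂ :=
  ((Real.exp ((∑ j, x j) ^ 3 / 24) /
      ((∑ j, x j) * ∏ j, Real.sqrt (2 * Real.pi * x j)) : ℝ) : ℂ) *
    ∫ a : Fin n → ℝ, buryakIntegrand n x a

/-- The integrand of `ℰ(x_1, …, x_n)`. The cyclic successor of `j` is `finRotate n j`. -/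
def okounkovIntegrand (n : ℕ) (x s : Fin n → ℝ) : ℝ :=
  Real.exp (-∑ j, ((s j - s (finRotate n j)) ^ 2 / (4 * x j)
    + (s j + s (finRotate n j)) * x j / 2))

/-- Okounkov's `ℰ(x_1, …, x_n)`. -/
def okounkovE (n : ℕ) (x : Fin n → ℝ) : ℝ :=
  Real.exp ((∑ j, x j ^ 3) / 12) / (∏ j, Real.sqrt (4 * Real.pi * x j)) *
    ∫ s in {s : Fin n → ℝ | ∀ j, 0 ≤ s j}, okounkovIntegrand n x s

/-- `ℰ` is invariant under permutations commuting with the cyclic rotation. -/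
theorem okounkovE_comp_of_commute (n : ℕ) (x : Fin n → ℝ) (c : Equiv.Perm (Fin n))
    (hc : ∀ j, c (finRotate n j) = finRotate n (c j)) :
    okounkovE n (fun j => x (c j)) = okounkovE n x := by
  have hmp := volume_measurePreserving_piCongrLeft (fun _ : Fin n => ℝ) c
  have hap : ∀ (s : Fin n → ℝ) (j : Fin n),
      (MeasurableEquiv.piCongrLeft (fun _ : Fin n => ℝ) c) s (c j) = s j := by
    intro s j
    exact Equiv.piCongrLeft_apply_apply (P := fun _ : Fin n => ℝ) c s j
  have hset : (MeasurableEquiv.piCongrLeft (fun _ : Fin n => ℝ) c) ⁻¹'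
      {s : Fin n → ℝ | ∀ j, 0 ≤ s j} = {s : Fin n → ℝ | ∀ j, 0 ≤ s j} := by
    ext s
    simp only [Set.mem_preimage, Set.mem_ofPred_eq]
    constructor
    · intro h j
      rw [← hap s j]
      exact h (c j)
    · intro h j
      obtain ⟨i, rfl⟩ := c.surjective j
      rw [hap s i]
      exact h i
  have hint := hmp.setIntegral_preimage_emb
    (MeasurableEquiv.measurableEmbedding _) (okounkovIntegrand n x)
    {s : Fin n → ℝ | ∀ j, 0 ≤ s j}
  rw [hset] at hint
  unfold okounkovE
  rw [← hint, Equiv.sum_comp c (fun j => x j ^ 3),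
    Equiv.prod_comp c (fun j => Real.sqrt (4 * Real.pi * x j))]
  congr 2
  funext s
  unfold okounkovIntegrand
  congr 2
  rw [← Equiv.sum_comp c (fun j => ((MeasurableEquiv.piCongrLeft (fun _ : Fin n => ℝ) c) s j -
    (MeasurableEquiv.piCongrLeft (fun _ : Fin n => ℝ) c) s (finRotate n j)) ^ 2 / (4 * x j)
    + ((MeasurableEquiv.piCongrLeft (fun _ : Fin n => ℝ) c) s j +
    (MeasurableEquiv.piCongrLeft (fun _ : Fin n => ℝ) c) s (finRotate n j)) * x j / 2)]
  refine Finset.sum_congr rfl fun j _ => ?_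
  rw [← hc, hap, hap]

/-- The cyclic group `ℤ_n`, as the subgroup of `S_n` generated by the rotation `j ↦ j + 1`. -/
abbrev rotations (n : ℕ) : Subgroup (Equiv.Perm (Fin n)) := Subgroup.zpowers (finRotate n)

/-- The summand `ℰ(x_{σ(1)}, …, x_{σ(n)})` as a function of the class of `σ` in `S_n / ℤ_n`
(the class of `σ` consists of the `σ ∘ c` with `c` a rotation). -/
def okounkovTerm (n : ℕ) (x : Fin n → ℝ) : Equiv.Perm (Fin n) ⧸ rotations n → ℝ :=
  Quotient.lift (fun σ : Equiv.Perm (Fin n) => okounkovE n fun j => x (σ j)) (by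
    intro σ τ h
    obtain ⟨k, hk⟩ := Subgroup.mem_zpowers_iff.mp (QuotientGroup.leftRel_apply.mp h)
    have hτ : τ = σ * finRotate n ^ k := by rw [hk]; group
    subst hτ
    refine (okounkovE_comp_of_commute n (fun j => x (σ j)) (finRotate n ^ k) fun j => ?_).symm
    rw [← Equiv.Perm.mul_apply, ← Equiv.Perm.mul_apply, (Commute.refl _).zpow_left k |>.eq])

open scoped Classical in
/-- The cyclic sum `ℰ^↻(x_1, …, x_n)`, a sum over `S_n / ℤ_n`. -/
def okounkovCyclic (n : ℕ) (x : Fin n → ℝ) : ℝ :=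
  ∑ q : Equiv.Perm (Fin n) ⧸ rotations n, okounkovTerm n x q

/-- `ℰ^↻` is symmetric, so it may be evaluated on an unordered family. -/
theorem okounkovCyclic_comp_perm (n : ℕ) (x : Fin n → ℝ) (ρ : Equiv.Perm (Fin n)) :
    okounkovCyclic n (fun j => x (ρ j)) = okounkovCyclic n x := by
  classical
  unfold okounkovCyclic
  rw [← Equiv.sum_comp (MulAction.toPerm ρ) (okounkovTerm n x)]
  refine Finset.sum_congr rfl fun q _ => ?_
  induction q using Quotient.inductionOn
  rfl

/-- `𝒢(x_1, …, x_n)`: the alternating sum over the set partitions of the index set. The blocks of a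
partition are listed in some order, which does not matter by `okounkovCyclic_comp_perm`. -/
def okounkovG (n : ℕ) (x : Fin n → ℝ) : ℝ :=
  ∑ π : Finpartition (Finset.univ : Finset (Fin n)),
    (-1 : ℝ) ^ (π.parts.card + 1) *
      okounkovCyclic π.parts.card
        (fun j => ∑ i ∈ (π.parts.equivFin.symm j : Finset (Fin n)), x i)

/-- Okounkov's formula for the `n`-point function. -/
def okounkovF (n : ℕ) (x : Fin n → ℝ) : ℝ :=
  (2 * Real.pi) ^ ((n : ℝ) / 2) / (∏ j, Real.sqrt (x j)) *
    okounkovG n (fun j => x j / (2 : ℝ) ^ ((1 : ℝ) / 3))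

end

/-! Both sides compute the mass of one polyhedron under the centered Gaussian with variances `x`.
Write X for the total of the `x i`, and f(S) for the sum of f over S. The polyhedron `zonotope x`
consists of the ξ such that, for every S, ξ(S) minus its proportional share x(S)/X of the total of ξ
is at most x(S)(X - x(S))/2. It is invariant along the direction `x` and bounded across it.

Buryak's side. Each ζ is a difference of two exponentials, so a summand of `P_n` is a nested
commutator of exponentials, with denominators in `a j / x j`. Partial fractions rewrite the sum of
these commutators as a sum over all words (`sum_nestedFrom_singleton`, `buryakP_eq_sum_words`). This
word sum is a vertex formula: each word gives the transform of a signed cone at a vertex of the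
zonotope (`cone_transform`), and the signed cones add up to the indicator
(`indicator_zonotope_eq_sum_perm`). Hence `P_n` is a Fourier transform of the zonotope
(`setIntegral_zonotope`), and integrating over `a` against the Gaussian yields Gaussian mass
(`buryakF_eq`).

Okounkov's side. The same indicator is an alternating sum over ordered set partitions of products of
half-space indicators (`sum_blockProd`). Such a product depends only on block sums, which are again
independent Gaussians (`map_gaussPi`). In the coordinates given by the defects of final segments,
the Gaussian exponent becomes Okounkov's cyclic form with one variable set to zero
(`sum_sq_div_eq`). Conversely, Okounkov's orthant splits according to its smallest coordinate:
integrating that coordinate out leaves the same integral (`setIntegral_minRegion_zero`), and its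
position accounts for the rotations (`okounkovE_eq`). Thus linear orders of the blocks match cyclic
orders with a marked point.

The two expansions of the indicator agree because both reduce to an alternating sum over chains of
sets of positive defect. Supermodularity of the defect makes this sum vanish as soon as such a set
exists (`sum_ssubsets_altChain`). -/

open MeasureTheory

/-! ### Words: enumerations of a finite set -/

section Words

variable {α : Type*} [DecidableEq α]

/-- The lists enumerating the elements of `S` without repetition. -/
def words (S : Finset α) : Finset (List α) := S.val.lists.toFinset

theorem mem_words {S : Finset α} {l : List α} : l ∈ words S ↔ l.Nodup ∧ l.toFinset = S := by
  unfold words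
  rw [Multiset.mem_toFinset, Multiset.mem_lists_iff]
  constructor
  · intro h
    have h' : S.val = (l : Multiset α) := h
    have hn : l.Nodup := by
      rw [← Multiset.coe_nodup, ← h']; exact S.nodup
    refine ⟨hn, ?_⟩
    ext a
    rw [List.mem_toFinset, ← Multiset.mem_coe, ← h', Finset.mem_val]
  · rintro ⟨hn, rfl⟩
    change _ = (l : Multiset α)
    rw [List.toFinset_val, hn.dedup]

theorem words_empty : words (∅ : Finset α) = {[]} := by
  ext l
  rw [mem_words, Finset.mem_singleton, List.toFinset_eq_empty_iff]
  constructor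
  · exact fun h => h.2
  · rintro rfl; simp

theorem mem_of_mem_words {S : Finset α} {l : List α} (h : l ∈ words S) {a : α} :
    a ∈ l ↔ a ∈ S := by
  rw [← (mem_words.mp h).2, List.mem_toFinset]

theorem cons_mem_words {S : Finset α} {q : α} {l : List α} :
    q :: l ∈ words S ↔ q ∈ S ∧ l ∈ words (S.erase q) := by
  simp only [mem_words, List.nodup_cons, List.toFinset_cons]
  constructor
  · rintro ⟨⟨hq, hn⟩, rfl⟩
    refine ⟨Finset.mem_insert_self _ _, hn, ?_⟩
    rw [Finset.erase_insert (by simpa using hq)]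
  · rintro ⟨hq, hn, hl⟩
    refine ⟨⟨?_, hn⟩, ?_⟩
    · rw [← List.mem_toFinset, hl]; simp
    · rw [hl, Finset.insert_erase hq]

theorem sum_words_cons {M : Type*} [AddCommMonoid M] {S : Finset α} (hS : S.Nonempty)
    (f : List α → M) :
    ∑ l ∈ words S, f l = ∑ q ∈ S, ∑ l ∈ words (S.erase q), f (q :: l) := by
  rw [Finset.sum_sigma']
  symm
  refine Finset.sum_bij (fun x _ => x.1 :: x.2) ?_ ?_ ?_ ?_
  · rintro ⟨q, l⟩ h
    rw [Finset.mem_sigma] at h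
    exact cons_mem_words.mpr h
  · rintro ⟨q, l⟩ _ ⟨q', l'⟩ _ h
    simp only [List.cons.injEq] at h
    obtain ⟨rfl, rfl⟩ := h
    rfl
  · intro l hl
    match l, hl with
    | [], hl =>
      obtain ⟨a, ha⟩ := hS
      exact absurd ((mem_of_mem_words hl).mpr ha) (by simp)
    | q :: l, hl => exact ⟨⟨q, l⟩, Finset.mem_sigma.mpr (cons_mem_words.mp hl), rfl⟩
  · intros; rfl

/-- A word is cut at its letter `p`. The left piece is reversed so that both pieces are read outward
from `p`, as left and right sums require. -/
theorem sum_words_split {M : Type*} [AddCommMonoid M] {S : Finset α} {p : α} (hp : p ∉ S)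
    (f : List α → M) :
    ∑ l ∈ words (insert p S), f l =
      ∑ L ∈ S.powerset, ∑ l₁ ∈ words L, ∑ l₂ ∈ words (S \ L), f (l₁.reverse ++ p :: l₂) := by
  simp_rw [Finset.sum_sigma']
  symm
  refine Finset.sum_bij (fun x _ => x.2.1.reverse ++ p :: x.2.2) ?_ ?_ ?_ ?_
  · rintro ⟨L, l₁, l₂⟩ h
    simp only [Finset.mem_sigma, Finset.mem_powerset, mem_words] at h
    obtain ⟨hL, ⟨h1, rfl⟩, h2, h3⟩ := h
    have hp1 : p ∉ l₁ := fun h => hp (hL (by simpa using h))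
    have hp2 : p ∉ l₂ := fun h => hp (by
      have : p ∈ l₂.toFinset := by simpa using h
      rw [h3] at this; exact (Finset.mem_sdiff.mp this).1)
    have hd : ∀ a ∈ l₁, a ∉ l₂ := fun a ha hb => by
      have : a ∈ l₂.toFinset := by simpa using hb
      rw [h3] at this
      exact (Finset.mem_sdiff.mp this).2 (by simpa using ha)
    rw [mem_words]
    constructor
    · rw [List.nodup_append]
      refine ⟨List.nodup_reverse.mpr h1, List.nodup_cons.mpr ⟨hp2, h2⟩, ?_⟩
      intro a ha b hb
      rw [List.mem_reverse] at ha
      rcases List.mem_cons.mp hb with rfl | hb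
      · rintro rfl; exact hp1 ha
      · rintro rfl; exact hd _ ha hb
    · rw [List.toFinset_append, List.toFinset_cons, h3, List.toFinset_reverse]
      ext a
      have := @hL a
      simp only [Finset.mem_union, Finset.mem_insert, Finset.mem_sdiff] at *
      tauto
  · rintro ⟨L, l₁, l₂⟩ h ⟨L', l₁', l₂'⟩ h' he
    simp only [Finset.mem_sigma, Finset.mem_powerset, mem_words] at h h'
    obtain ⟨hL, ⟨h1, rfl⟩, h2, h3⟩ := h
    obtain ⟨hL', ⟨h1', rfl⟩, h2', h3'⟩ := h'
    have hp1 : p ∉ l₁ := fun h => hp (hL (by simpa using h))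
    have hp1' : p ∉ l₁' := fun h => hp (hL' (by simpa using h))
    have hp2 : p ∉ l₂ := fun h => hp (by
      have : p ∈ l₂.toFinset := by simpa using h
      rw [h3] at this; exact (Finset.mem_sdiff.mp this).1)
    obtain ⟨h4, -, rfl⟩ := (List.append_cons_inj_of_notMem (by simpa using hp1) hp2).mp he
    obtain rfl := List.reverse_injective h4
    rfl
  · intro l hl
    have hpl : p ∈ l := (mem_of_mem_words hl).mpr (Finset.mem_insert_self _ _)
    obtain ⟨s, t, rfl⟩ := List.append_of_mem hpl
    obtain ⟨hn, hf⟩ := mem_words.mp hl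
    rw [List.nodup_append] at hn
    obtain ⟨hs, hpt, hd⟩ := hn
    have hps : p ∉ s := fun h => hd p h p (by simp) rfl
    rw [List.nodup_cons] at hpt
    have hmem : ∀ a, (a ∈ s ∨ a = p ∨ a ∈ t) ↔ (a = p ∨ a ∈ S) := by
      intro a
      have := Finset.ext_iff.mp hf a
      simpa only [List.mem_toFinset, List.mem_append, List.mem_cons, Finset.mem_insert] using this
    refine ⟨⟨s.toFinset, s.reverse, t⟩, ?_, by simp⟩
    simp only [Finset.mem_sigma, Finset.mem_powerset, mem_words, List.nodup_reverse,
      List.toFinset_reverse]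
    refine ⟨?_, ⟨hs, trivial⟩, hpt.2, ?_⟩
    · intro a ha
      rw [List.mem_toFinset] at ha
      rcases (hmem a).mp (Or.inl ha) with rfl | h
      · exact absurd ha hps
      · exact h
    · ext a
      have h1 := hmem a
      have h2 : a ∈ s → a ∉ t := fun h h' => hd a h a (by simp [h']) rfl
      have h3 : a = p → a ∉ t := by rintro rfl; exact hpt.1
      have h4 : a = p → a ∉ S := by rintro rfl; exact hp
      simp only [List.mem_toFinset, Finset.mem_sdiff]
      tauto
  · intros; rfl

theorem sum_words_perm {M : Type*} [AddCommMonoid M] {k : ℕ} {S : Finset α} {e : Fin k → α}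
    (he : Function.Injective e) (hS : Finset.univ.image e = S) (f : List α → M) :
    ∑ l ∈ words S, f l = ∑ σ : Equiv.Perm (Fin k), f (List.ofFn fun j => e (σ j)) := by
  symm
  refine Finset.sum_bij (fun σ _ => List.ofFn fun j => e (σ j)) ?_ ?_ ?_ ?_
  · intro σ _
    rw [mem_words]
    refine ⟨List.nodup_ofFn.mpr (he.comp σ.injective), ?_⟩
    rw [← hS]
    ext a
    simp only [List.mem_toFinset, List.mem_ofFn, Finset.mem_image, Finset.mem_univ, true_and]
    exact (σ.surjective.exists (p := fun y => e y = a)).symm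
  · intro σ _ τ _ h
    have := List.ofFn_injective h
    ext j
    exact congrArg _ (he (congrFun this j))
  · intro l hl
    obtain ⟨hn, hf⟩ := mem_words.mp hl
    have hlen : l.length = k := by
      rw [← List.toFinset_card_of_nodup hn, hf, ← hS, Finset.card_image_of_injective _ he]
      simp
    subst hlen
    have hex : ∀ j : Fin l.length, ∃ i, e i = l.get j := by
      intro j
      have : l.get j ∈ S := by rw [← hf]; simp
      rw [← hS] at this
      simpa using this
    choose σ hσ using hex
    have hinj : Function.Injective σ := by
      intro i j hij
      apply List.nodup_iff_injective_get.mp hn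
      rw [← hσ, ← hσ, hij]
    refine ⟨Equiv.ofBijective σ (Finite.injective_iff_bijective.mp hinj), Finset.mem_univ _, ?_⟩
    conv_rhs => rw [← List.ofFn_get l]
    congr 1
    funext j
    exact hσ j
  · intros; rfl

end Words

/-! ### Chain sums and nested commutators -/

section Chains

variable {α K : Type*} [Field K]

/-- The product of the `(u i - u j)⁻¹` over the consecutive letters `i`, `j` of the word `p :: l`. -/
def chainFrom (u : α → K) : α → List α → K
  | _, [] => 1
  | p, q :: l => (u p - u q)⁻¹ * chainFrom u q l

/-- The product of the `(u i - u j)⁻¹` over the consecutive letters `i`, `j` of a word. -/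
def chainOf (u : α → K) : List α → K
  | [] => 1
  | p :: l => chainFrom u p l

/-- The product of `e i j` over the pairs of letters of a word with `i` before `j`. -/
def pairProd (e : α → α → K) : List α → K
  | [] => 1
  | p :: l => (l.map (e p)).prod * pairProd e l

theorem pairProd_append (e : α → α → K) (l₁ l₂ : List α) :
    pairProd e (l₁ ++ l₂) =
      pairProd e l₁ * pairProd e l₂ * (l₁.map fun i => (l₂.map (e i)).prod).prod := by
  induction l₁ with
  | nil => simp [pairProd]
  | cons p l ih =>
    simp only [List.cons_append, pairProd, List.map_append, List.prod_append, ih, List.map_cons,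
      List.prod_cons]
    ring

/-- Reading the left piece outward from `p` flips each of its differences, one sign per letter. -/
theorem chainOf_reverse_append (u : α → K) (l₁ : List α) (p : α) (l₂ : List α) :
    chainOf u (l₁.reverse ++ p :: l₂) =
      (-1) ^ l₁.length * chainFrom u p l₁ * chainFrom u p l₂ := by
  induction l₁ generalizing p l₂ with
  | nil => simp [chainOf, chainFrom]
  | cons q l ih =>
    rw [List.reverse_cons, List.append_assoc, List.singleton_append, ih]
    simp only [chainFrom, List.length_cons, pow_succ]
    rw [← neg_sub (u p) (u q), inv_neg]
    ring

variable [DecidableEq α]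

/-- The weight of a nested commutator: letters are appended one by one, each contributing the
difference of the two ways to multiply it with the set `U` of the previous letters. -/
def nestedFrom (u : α → K) (e : α → α → K) : Finset α → α → List α → K
  | _, _, [] => 1
  | U, p, q :: l => (u p - u q)⁻¹ * (∏ i ∈ U, e i q - ∏ i ∈ U, e q i) *
      nestedFrom u e (insert q U) q l

/-- Sum over the words that continue `p` to the right. -/
def rightSum (u : α → K) (e : α → α → K) (p : α) (S : Finset α) : K :=
  ∑ l ∈ words S, chainFrom u p l * pairProd e l

/-- Sum over the words that continue `p` to the left. -/
def leftSum (u : α → K) (e : α → α → K) (p : α) (S : Finset α) : K :=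
  ∑ l ∈ words S, (-1) ^ l.length * chainFrom u p l * pairProd e l.reverse

theorem prod_map_of_mem_words {S : Finset α} {l : List α} (h : l ∈ words S) (f : α → K) :
    (l.map f).prod = ∏ i ∈ S, f i := by
  obtain ⟨hn, rfl⟩ := mem_words.mp h
  rw [List.prod_toFinset f hn]

theorem rightSum_empty (u : α → K) (e : α → α → K) (p : α) : rightSum u e p ∅ = 1 := by
  simp [rightSum, words_empty, chainFrom, pairProd]

theorem leftSum_empty (u : α → K) (e : α → α → K) (p : α) : leftSum u e p ∅ = 1 := by
  simp [leftSum, words_empty, chainFrom, pairProd]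

theorem rightSum_eq (u : α → K) (e : α → α → K) (p : α) {S : Finset α} (hS : S.Nonempty) :
    rightSum u e p S = ∑ r ∈ S, (u p - u r)⁻¹ * (∏ i ∈ S.erase r, e r i) *
      rightSum u e r (S.erase r) := by
  unfold rightSum
  rw [sum_words_cons hS]
  refine Finset.sum_congr rfl fun r _ => ?_
  rw [Finset.mul_sum]
  refine Finset.sum_congr rfl fun l hl => ?_
  simp only [chainFrom, pairProd]
  rw [prod_map_of_mem_words hl]
  ring

theorem leftSum_eq (u : α → K) (e : α → α → K) (p : α) {S : Finset α} (hS : S.Nonempty) :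
    leftSum u e p S = -∑ r ∈ S, (u p - u r)⁻¹ * (∏ i ∈ S.erase r, e i r) *
      leftSum u e r (S.erase r) := by
  unfold leftSum
  rw [sum_words_cons hS, ← Finset.sum_neg_distrib]
  refine Finset.sum_congr rfl fun r _ => ?_
  rw [Finset.mul_sum, ← Finset.sum_neg_distrib]
  refine Finset.sum_congr rfl fun l hl => ?_
  rw [List.reverse_cons, pairProd_append]
  have h : (l.reverse.map fun i => (([r] : List α).map (e i)).prod).prod =
      ∏ i ∈ S.erase r, e i r := by
    rw [List.map_reverse, List.prod_reverse, ← prod_map_of_mem_words hl]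
    simp
  rw [h]
  simp only [chainFrom, pairProd, List.length_cons, pow_succ, List.map_nil, List.prod_nil]
  ring

/-- Partial fractions for the product of a left and a right sum. -/
theorem leftSum_mul_rightSum (u : α → K) (e : α → α → K) {p : α} {L R : Finset α}
    (hu : Set.InjOn u (insert p (L ∪ R) : Finset α)) (hpL : p ∉ L) (hpR : p ∉ R)
    (hLR : Disjoint L R) (hne : (L ∪ R).Nonempty) :
    leftSum u e p L * rightSum u e p R =
      ∑ r ∈ R, (u p - u r)⁻¹ * (∏ i ∈ R.erase r, e r i) * rightSum u e r (R.erase r) *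
        leftSum u e r L -
      ∑ r ∈ L, (u p - u r)⁻¹ * (∏ i ∈ L.erase r, e i r) * leftSum u e r (L.erase r) *
        rightSum u e r R := by
  -- With one side empty the identity is just the recursion for the other side.
  rcases L.eq_empty_or_nonempty with rfl | hL
  · simp only [leftSum_empty, one_mul, mul_one, Finset.sum_empty, sub_zero]
    exact rightSum_eq u e p (by simpa using hne)
  rcases R.eq_empty_or_nonempty with rfl | hR
  · simp only [rightSum_empty, mul_one, Finset.sum_empty, zero_sub]
    exact leftSum_eq u e p hL
  have h1 : ∀ r, leftSum u e r L = _ := fun r => leftSum_eq u e r hL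
  have h2 : ∀ r, rightSum u e r R = _ := fun r => rightSum_eq u e r hR
  simp only [h1, h2]
  rw [neg_mul, Finset.sum_mul_sum]
  simp only [Finset.mul_sum, mul_neg, Finset.sum_neg_distrib]
  rw [Finset.sum_comm (s := R), ← neg_add', ← Finset.sum_add_distrib]
  congr 1
  refine Finset.sum_congr rfl fun l hl => ?_
  rw [← Finset.sum_add_distrib]
  refine Finset.sum_congr rfl fun r hr => ?_
  have hne1 : u p - u l ≠ 0 := sub_ne_zero.mpr fun h => hpL (by
    rw [hu (by simp) (by simp [hl]) h]; exact hl)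
  have hne2 : u p - u r ≠ 0 := sub_ne_zero.mpr fun h => hpR (by
    rw [hu (by simp) (by simp [hr]) h]; exact hr)
  have hne3 : u l - u r ≠ 0 := sub_ne_zero.mpr fun h => Finset.disjoint_left.mp hLR hl (by
    rw [hu (by simp [hl]) (by simp [hr]) h]; exact hr)
  have hne4 : u r - u l ≠ 0 := by rw [← neg_sub]; exact neg_ne_zero.mpr hne3
  -- The neighbours `l` and `r` of `p` compete: in one term `r` becomes the new root carrying `l`,
  -- in the other `l` becomes the root carrying `r`.
  have key : (u p - u l)⁻¹ * (u p - u r)⁻¹ =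
      (u p - u r)⁻¹ * (u r - u l)⁻¹ + (u p - u l)⁻¹ * (u l - u r)⁻¹ := by
    rw [← neg_sub (u r) (u l), inv_neg]
    field_simp
    ring
  linear_combination (∏ i ∈ L.erase l, e i l) * leftSum u e l (L.erase l) *
    (∏ i ∈ R.erase r, e r i) * rightSum u e r (R.erase r) * key

theorem sum_powerset_sum_sdiff {M : Type*} [AddCommMonoid M] (S : Finset α)
    (F : Finset α → α → M) :
    ∑ L ∈ S.powerset, ∑ r ∈ S \ L, F L r = ∑ r ∈ S, ∑ L ∈ (S.erase r).powerset, F L r := by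
  refine Finset.sum_comm' fun L r => ?_
  simp only [Finset.mem_powerset, Finset.mem_sdiff, Finset.subset_erase]
  tauto

theorem sum_powerset_sum_mem {M : Type*} [AddCommMonoid M] (S : Finset α)
    (F : Finset α → α → M) :
    ∑ L ∈ S.powerset, ∑ r ∈ L, F L r =
      ∑ r ∈ S, ∑ L ∈ (S.erase r).powerset, F (insert r L) r := by
  rw [Finset.sum_comm' (t' := S) (s' := fun r => S.powerset.filter (r ∈ ·))]
  · refine Finset.sum_congr rfl fun r hr => ?_
    symm
    refine Finset.sum_bij (fun L _ => insert r L) ?_ ?_ ?_ ?_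
    · intro L hL
      rw [Finset.mem_powerset, Finset.subset_erase] at hL
      simp only [Finset.mem_filter, Finset.mem_powerset, Finset.mem_insert_self, and_true]
      exact Finset.insert_subset hr hL.1
    · intro L hL L' hL' h
      rw [Finset.mem_powerset, Finset.subset_erase] at hL hL'
      rw [← Finset.erase_insert hL.2, h, Finset.erase_insert hL'.2]
    · intro L hL
      simp only [Finset.mem_filter, Finset.mem_powerset] at hL
      refine ⟨L.erase r, ?_, Finset.insert_erase hL.2⟩
      rw [Finset.mem_powerset]
      exact Finset.erase_subset_erase _ hL.1
    · intros; rfl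
  · intro L r
    simp only [Finset.mem_powerset, Finset.mem_filter]
    constructor
    · rintro ⟨h1, h2⟩; exact ⟨⟨h1, h2⟩, h1 h2⟩
    · rintro ⟨⟨h1, h2⟩, -⟩; exact ⟨h1, h2⟩

/-- The sum of nested commutators in terms of left and right sums. -/
theorem sum_nestedFrom (u : α → K) (e : α → α → K) {p : α} {U S : Finset α}
    (hu : Set.InjOn u (insert p S : Finset α)) (hpS : p ∉ S) (hUS : Disjoint U S) :
    ∑ l ∈ words S, nestedFrom u e U p l =
      ∑ L ∈ S.powerset, leftSum u e p L * rightSum u e p (S \ L) *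
        ((∏ i ∈ L, ∏ j ∈ U, e i j) * (∏ i ∈ U, ∏ j ∈ S \ L, e i j) *
          ∏ i ∈ L, ∏ j ∈ S \ L, e i j) := by
  induction hc : S.card generalizing p U S with
  | zero =>
    rw [Finset.card_eq_zero] at hc
    subst hc
    simp [words_empty, nestedFrom, leftSum_empty, rightSum_empty]
  | succ k ih =>
    have hS : S.Nonempty := Finset.card_pos.mp (by omega)
    -- The root moves from `p` to a letter `r`, lying on the right with sign + or on the left with
    -- sign -. These are the two terms of the commutator that appends `r`, so exchanging sums and
    -- fixing `r = q` matches the first letter of the nested word.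
    have hstep : ∀ L ∈ S.powerset, leftSum u e p L * rightSum u e p (S \ L) =
      ∑ r ∈ S \ L, (u p - u r)⁻¹ * (∏ i ∈ (S \ L).erase r, e r i) *
          rightSum u e r ((S \ L).erase r) * leftSum u e r L -
        ∑ r ∈ L, (u p - u r)⁻¹ * (∏ i ∈ L.erase r, e i r) * leftSum u e r (L.erase r) *
          rightSum u e r (S \ L) := by
      intro L hL
      rw [Finset.mem_powerset] at hL
      have hun : L ∪ S \ L = S := Finset.union_sdiff_of_subset hL
      refine leftSum_mul_rightSum u e ?_ ?_ ?_ Finset.disjoint_sdiff ?_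
      · rwa [hun]
      · exact fun h => hpS (hL h)
      · exact fun h => hpS (Finset.mem_sdiff.mp h).1
      · rwa [hun]
    rw [Finset.sum_congr (s₁ := S.powerset) rfl fun L hL => by
        rw [hstep L hL, sub_mul, Finset.sum_mul, Finset.sum_mul],
      Finset.sum_sub_distrib,
      sum_powerset_sum_sdiff S (fun L r => (u p - u r)⁻¹ * (∏ i ∈ (S \ L).erase r, e r i) *
          rightSum u e r ((S \ L).erase r) * leftSum u e r L *
        ((∏ i ∈ L, ∏ j ∈ U, e i j) * (∏ i ∈ U, ∏ j ∈ S \ L, e i j) *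
          ∏ i ∈ L, ∏ j ∈ S \ L, e i j)),
      sum_powerset_sum_mem S (fun L r => (u p - u r)⁻¹ * (∏ i ∈ L.erase r, e i r) *
        leftSum u e r (L.erase r) * rightSum u e r (S \ L) *
        ((∏ i ∈ L, ∏ j ∈ U, e i j) * (∏ i ∈ U, ∏ j ∈ S \ L, e i j) *
          ∏ i ∈ L, ∏ j ∈ S \ L, e i j)),
      ← Finset.sum_sub_distrib, sum_words_cons hS]
    refine Finset.sum_congr rfl fun q hq => ?_
    simp only [nestedFrom]
    have hqU : q ∉ U := fun h => Finset.disjoint_left.mp hUS h hq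
    rw [← Finset.mul_sum, ih (p := q) (U := insert q U) (S := S.erase q) ?_ (by simp) ?_ ?_,
      Finset.mul_sum, ← Finset.sum_sub_distrib]
    · refine Finset.sum_congr rfl fun L hL => ?_
      rw [Finset.mem_powerset, Finset.subset_erase] at hL
      have e1 : S \ L = insert q (S.erase q \ L) := by
        rw [← Finset.insert_sdiff_of_notMem _ hL.2, Finset.insert_erase hq]
      have hq' : q ∉ S.erase q \ L := by simp
      have e2 : S \ insert q L = S.erase q \ L := by
        ext a; simp only [Finset.mem_sdiff, Finset.mem_insert, Finset.mem_erase]; tauto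
      rw [e1, e2, Finset.erase_insert hq', Finset.erase_insert hL.2]
      simp only [Finset.prod_insert hq', Finset.prod_insert hL.2, Finset.prod_insert hqU,
        Finset.prod_mul_distrib]
      ring
    · refine hu.mono ?_
      rw [Finset.insert_erase hq]
      simp
    · rw [Finset.disjoint_insert_left]
      exact ⟨by simp, hUS.mono_right (Finset.erase_subset _ _)⟩
    · rw [Finset.card_erase_of_mem hq]; omega

/-- The sum of nested commutators starting with `p` is the sum over all words. -/
theorem sum_nestedFrom_singleton (u : α → K) (e : α → α → K) {p : α} {S : Finset α}
    (hu : Set.InjOn u (insert p S : Finset α)) (hpS : p ∉ S) :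
    ∑ l ∈ words S, nestedFrom u e {p} p l =
      ∑ l ∈ words (insert p S), chainOf u l * pairProd e l := by
  rw [sum_nestedFrom u e hu hpS (by simpa using hpS), sum_words_split hpS]
  refine Finset.sum_congr rfl fun L hL => ?_
  unfold leftSum rightSum
  rw [Finset.sum_mul_sum, Finset.sum_mul]
  refine Finset.sum_congr rfl fun l₁ h₁ => ?_
  rw [Finset.sum_mul]
  refine Finset.sum_congr rfl fun l₂ h₂ => ?_
  rw [chainOf_reverse_append, pairProd_append]
  simp only [pairProd, List.map_cons, List.prod_cons, List.map_reverse, List.prod_reverse,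
    prod_map_of_mem_words h₂, prod_map_of_mem_words h₁, Finset.prod_singleton,
    Finset.prod_mul_distrib]
  ring

end Chains

/-! ### Buryak's function as a sum over words -/

section BuryakWords

theorem nestedFrom_ofFn {α K : Type*} [Field K] [DecidableEq α] (u : α → K) (e : α → α → K)
    {k : ℕ} (w : Fin k → α) (U : Finset α) (p : α) :
    nestedFrom u e U p (List.ofFn w) =
      ∏ j : Fin k, (u ((Fin.cons p w : Fin (k + 1) → α) j.castSucc) - u (w j))⁻¹ *
        (∏ i ∈ U ∪ (Finset.Iio j).image w, e i (w j) -
          ∏ i ∈ U ∪ (Finset.Iio j).image w, e (w j) i) := by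
  induction k generalizing U p with
  | zero => simp [nestedFrom]
  | succ k ih =>
    rw [List.ofFn_succ, nestedFrom, ih, Fin.prod_univ_succ]
    have h0 : (Finset.Iio (0 : Fin (k + 1))).image w = ∅ := by
      rw [Finset.image_eq_empty]
      ext a
      simp
    congr 1
    · rw [h0, Finset.union_empty]
      simp
    · refine Finset.prod_congr rfl fun j _ => ?_
      have h1 : insert (w 0) U ∪ (Finset.Iio j).image (fun i => w i.succ) =
          U ∪ (Finset.Iio j.succ).image w := by
        ext a
        simp only [Finset.mem_union, Finset.mem_insert, Finset.mem_image, Finset.mem_Iio]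
        constructor
        · rintro ((rfl | h) | ⟨i, hi, rfl⟩)
          · exact Or.inr ⟨0, Fin.succ_pos _, rfl⟩
          · exact Or.inl h
          · exact Or.inr ⟨i.succ, Fin.succ_lt_succ_iff.mpr hi, rfl⟩
        · rintro (h | ⟨i, hi, rfl⟩)
          · exact Or.inl (Or.inr h)
          · induction i using Fin.cases with
            | zero => exact Or.inl (Or.inl rfl)
            | succ i => exact Or.inr ⟨i, Fin.succ_lt_succ_iff.mp hi, rfl⟩
      rw [h1]
      congr 3
      rw [← Fin.succ_castSucc, Fin.cons_succ]
      congr 1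
      have : (Fin.cons (w 0) fun i => w i.succ : Fin (k + 1) → α) = w := Fin.cons_self_tail w
      exact congrFun this _

/-- The exponential pairing of two letters. -/
noncomputable def expPair {n : ℕ} (a x : Fin n → ℂ) (i j : Fin n) : ℂ :=
  Complex.exp ((a i * x j - a j * x i) / 2)

/-- The argument of ζ is bilinear, so each of its exponentials factors over `S`. The result is the
commutator of the letter `q` with the product of the letters in `S`. -/
theorem zetaFn_eq {n : ℕ} (a x : Fin n → ℂ) (S : Finset (Fin n)) (q : Fin n) :
    zetaFn ((∑ k ∈ S, a k) * x q - a q * ∑ k ∈ S, x k) =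
      ∏ i ∈ S, expPair a x i q - ∏ i ∈ S, expPair a x q i := by
  unfold zetaFn expPair
  rw [← Complex.exp_sum, ← Complex.exp_sum]
  congr 2
  · rw [← Finset.sum_div, Finset.sum_sub_distrib, Finset.sum_mul, Finset.mul_sum]
  · rw [← Finset.sum_div, Finset.sum_sub_distrib, Finset.sum_mul, Finset.mul_sum, ← neg_div,
      neg_sub]

/-- With `u = a / x`, each denominator is `x i * x j * (u i - u j)`. The interior letters of a word
occur twice among these factors and are compensated once by the numerator, leaving every `x j`
exactly once below. -/
theorem buryakP_eq_sum_words {n : ℕ} (hn : 1 ≤ n) (a x : Fin n → ℂ) (hx : ∀ j, x j ≠ 0)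
    (hu : Function.Injective fun j => a j / x j) :
    buryakP n a x = (∏ j, x j)⁻¹ *
      ∑ l ∈ words (Finset.univ : Finset (Fin n)),
        chainOf (fun j => a j / x j) l * pairProd (expPair a x) l := by
  match n, hn with
  | 1, _ =>
    rw [sum_words_cons (Finset.univ_nonempty)]
    simp [buryakP, words_empty, chainOf, chainFrom, pairProd]
  | m + 2, _ =>
    set u : Fin (m + 2) → ℂ := fun j => a j / x j with hudef
    have hins : (Finset.univ : Finset (Fin (m + 2))) = insert 0 (Finset.univ.erase 0) :=
      (Finset.insert_erase (Finset.mem_univ _)).symm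
    have hword : ∑ l ∈ words (Finset.univ : Finset (Fin (m + 2))),
        chainOf u l * pairProd (expPair a x) l =
        ∑ l ∈ words (Finset.univ.erase 0), nestedFrom u (expPair a x) {0} 0 l := by
      rw [sum_nestedFrom_singleton u _ (hu.injOn) (by simp), ← hins]
    rw [hword]
    -- Extension by zero to all words turns the sum over words without the letter 0 into the sum
    -- over permutations fixing 0.
    set G : List (Fin (m + 2)) → ℂ := fun l =>
      if l.head? = some 0 then nestedFrom u (expPair a x) {0} 0 l.tail else 0 with hG
    have h1 : ∑ l ∈ words (Finset.univ.erase (0 : Fin (m + 2))),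
        nestedFrom u (expPair a x) {0} 0 l = ∑ l ∈ words (Finset.univ : Finset (Fin (m + 2))), G l := by
      rw [sum_words_cons Finset.univ_nonempty, Finset.sum_eq_single (0 : Fin (m + 2))]
      · simp [hG]
      · intro b _ hb
        simp [hG, hb]
      · simp
    rw [h1, sum_words_perm Function.injective_id (S := Finset.univ) (by simp), Finset.mul_sum]
    simp only [buryakP]
    rw [Finset.sum_filter]
    refine Finset.sum_congr rfl fun τ _ => ?_
    by_cases hτ : τ 0 = 0
    · rw [if_pos hτ]
      have hlist : (List.ofFn fun j => id (τ j)) = 0 :: List.ofFn fun j : Fin (m + 1) => τ j.succ := by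
        rw [List.ofFn_succ]; simp [hτ]
      have hcons : (Fin.cons 0 (fun j : Fin (m + 1) => τ j.succ) : Fin (m + 2) → Fin (m + 2)) = τ := by
        have := Fin.cons_self_tail (τ : Fin (m + 2) → Fin (m + 2))
        rw [hτ] at this
        exact this
      rw [hlist, hG]
      simp only [List.head?_cons, if_true, List.tail_cons]
      rw [nestedFrom_ofFn, hcons]
      have hset : ∀ j : Fin (m + 1), {0} ∪ (Finset.Iio j).image (fun j : Fin (m + 1) => τ j.succ) =
          (Finset.Iic j.castSucc).image τ := by
        intro j
        ext b
        simp only [Finset.mem_union, Finset.mem_singleton, Finset.mem_image, Finset.mem_Iio,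
          Finset.mem_Iic]
        constructor
        · rintro (rfl | ⟨i, hi, rfl⟩)
          · exact ⟨0, Fin.zero_le _, hτ⟩
          · exact ⟨i.succ, Fin.succ_le_castSucc_iff.mpr hi, rfl⟩
        · rintro ⟨i, hi, rfl⟩
          induction i using Fin.cases with
          | zero => exact Or.inl hτ
          | succ i => exact Or.inr ⟨i, Fin.succ_le_castSucc_iff.mp hi, rfl⟩
      have hz : ∀ j : Fin (m + 1), zetaFn ((∑ k ∈ Finset.Iic j.castSucc, a (τ k)) * x (τ j.succ)
            - a (τ j.succ) * ∑ k ∈ Finset.Iic j.castSucc, x (τ k)) =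
          ∏ i ∈ {0} ∪ (Finset.Iio j).image (fun j : Fin (m + 1) => τ j.succ),
            expPair a x i (τ j.succ) -
          ∏ i ∈ {0} ∪ (Finset.Iio j).image (fun j : Fin (m + 1) => τ j.succ),
            expPair a x (τ j.succ) i := by
        intro j
        rw [hset, ← zetaFn_eq, Finset.sum_image τ.injective.injOn, Finset.sum_image τ.injective.injOn]
      rw [Finset.prod_congr rfl fun j _ => hz j, Finset.prod_mul_distrib]
      have hd : ∀ j : Fin (m + 1), a (τ j.castSucc) * x (τ j.succ) - a (τ j.succ) * x (τ j.castSucc)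
          = x (τ j.castSucc) * x (τ j.succ) * (u (τ j.castSucc) - u (τ j.succ)) := by
        intro j
        have h1 := hx (τ j.castSucc)
        have h2 := hx (τ j.succ)
        simp only [hudef]
        field_simp
      rw [Finset.prod_congr rfl fun j _ => hd j, Finset.prod_mul_distrib, Finset.prod_mul_distrib,
        Finset.prod_inv_distrib]
      have hX : ∏ j, x j = (∏ j : Fin (m + 1), x (τ j.castSucc)) * x (τ (Fin.last _)) := by
        rw [← Equiv.prod_comp τ x, Fin.prod_univ_castSucc]
      have hY : ∏ j : Fin (m + 1), x (τ j.succ) =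
          (∏ j : Fin m, x (τ j.castSucc.succ)) * x (τ (Fin.last _)) := by
        rw [Fin.prod_univ_castSucc, Fin.succ_last]
      rw [hX, hY]
      have h1 : ∏ j : Fin m, x (τ j.castSucc.succ) ≠ 0 := Finset.prod_ne_zero_iff.mpr fun j _ => hx _
      have h2 : ∏ j : Fin (m + 1), x (τ j.castSucc) ≠ 0 :=
        Finset.prod_ne_zero_iff.mpr fun j _ => hx _
      have h3 := hx (τ (Fin.last _))
      have h4 : ∏ j : Fin (m + 1), (u (τ j.castSucc) - u (τ j.succ)) ≠ 0 :=
        Finset.prod_ne_zero_iff.mpr fun j _ => sub_ne_zero.mpr fun h =>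
          (Fin.castSucc_lt_succ (i := j)).ne (τ.injective (hu h))
      rw [div_eq_iff (by positivity)]
      field_simp
    · rw [if_neg hτ, hG]
      simp [List.ofFn_succ, hτ]

end BuryakWords

/-! ### Alternating sums over chains of sets -/

section AltChains

variable {α : Type*} [DecidableEq α]

/-- The alternating sum over the chains of nonempty sets satisfying `P` with largest element `S`
(`1` for `S = ∅`, the empty chain). -/
noncomputable def altChain (P : Finset α → Prop) [DecidablePred P] (S : Finset α) : ℝ :=
  if S = ∅ then 1
  else if P S then -∑ T ∈ S.ssubsets.attach, altChain P T.1 else 0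
termination_by S.card
decreasing_by exact Finset.card_lt_card (Finset.mem_ssubsets.mp T.2)

theorem altChain_empty (P : Finset α → Prop) [DecidablePred P] : altChain P ∅ = 1 := by
  rw [altChain, if_pos rfl]

theorem altChain_eq (P : Finset α → Prop) [DecidablePred P] {S : Finset α} (hS : S.Nonempty) :
    altChain P S = if P S then -∑ T ∈ S.ssubsets, altChain P T else 0 := by
  rw [altChain, if_neg hS.ne_empty, Finset.sum_attach _ (fun T => altChain P T)]

theorem sum_powerset_altChain (P : Finset α → Prop) [DecidablePred P] {S : Finset α}
    (hS : S.Nonempty) (hP : P S) : ∑ T ∈ S.powerset, altChain P T = 0 := by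
  rw [← Finset.insert_erase (Finset.mem_powerset_self S),
    Finset.sum_insert (Finset.notMem_erase _ _), altChain_eq P hS, if_pos hP]
  exact neg_add_cancel _

/-- Sets where a supermodular function is positive: the alternating sum over all chains vanishes
unless there are no such sets. -/
theorem sum_ssubsets_altChain [Fintype α] [Nonempty α] (k : Finset α → ℝ)
    (hk : ∀ S T, k S + k T ≤ k (S ∪ T) + k (S ∩ T)) (h0 : k ∅ = 0) (h1 : k Finset.univ = 0) :
    ∑ S ∈ (Finset.univ : Finset α).ssubsets, altChain (fun S => 0 < k S) S =
      if ∀ S, k S ≤ 0 then 1 else 0 := by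
  have hP : ∀ S, 0 < k S → S.Nonempty := fun S h => by
    rw [Finset.nonempty_iff_ne_empty]; rintro rfl; exact h.ne' h0
  split_ifs with h
  · rw [Finset.sum_eq_single ∅, altChain_empty]
    · intro S _ hS
      rw [altChain_eq _ (Finset.nonempty_iff_ne_empty.mpr hS), if_neg (h S).not_gt]
    · intro hn
      exact absurd (Finset.mem_ssubsets.mpr (Finset.empty_ssubset.mpr Finset.univ_nonempty)) hn
  · push Not at h
    obtain ⟨S₀, hS₀⟩ := h
    -- For a maximizer `M`, supermodularity gives `k T ≤ k (T ∩ M)`. Intersecting with `M` therefore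
    -- preserves positivity, and the poset of positive sets contracts through T ⊇ T ∩ M ⊆ M.
    obtain ⟨M, -, hM⟩ := Finset.exists_max_image (Finset.univ : Finset (Finset α)) k ⟨∅, by simp⟩
    have hMpos : 0 < k M := hS₀.trans_le (hM S₀ (Finset.mem_univ _))
    have hinter : ∀ T, 0 < k T → 0 < k (T ∩ M) := by
      intro T hT
      have := hk T M
      have := hM (T ∪ M) (Finset.mem_univ _)
      linarith
    -- Inductively only subsets of `T ∩ M` contribute to the recursion at `T`, and their sum
    -- vanishes because `T ∩ M` is itself positive.
    have hzero : ∀ T, ¬ T ⊆ M → altChain (fun S => 0 < k S) T = 0 := by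
      intro T
      induction T using Finset.strongInduction with
      | H T ih =>
        intro hT
        have hTne : T.Nonempty := by
          rw [Finset.nonempty_iff_ne_empty]; rintro rfl; exact hT (Finset.empty_subset _)
        rw [altChain_eq _ hTne]
        split_ifs with hPT
        · rw [← Finset.sum_subset (s₁ := (T ∩ M).powerset),
            sum_powerset_altChain _ (hP _ (hinter T hPT)) (hinter T hPT), neg_zero]
          · intro A hA
            rw [Finset.mem_powerset] at hA
            rw [Finset.mem_ssubsets]
            refine Finset.ssubset_of_subset_of_ssubset hA
              (Finset.ssubset_iff_subset_ne.mpr ⟨Finset.inter_subset_left, fun h => hT ?_⟩)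
            exact Finset.inter_eq_left.mp h
          · intro A hA hA'
            rw [Finset.mem_ssubsets] at hA
            refine ih A hA fun h => hA' ?_
            exact Finset.mem_powerset.mpr (Finset.subset_inter hA.subset h)
        · rfl
    -- All subsets of `M` occur among the proper subsets of the whole set, since `k` vanishes on the
    -- latter and hence `M` is proper.
    rw [← Finset.sum_subset (s₁ := M.powerset), sum_powerset_altChain _ (hP M hMpos) hMpos]
    · intro A hA
      rw [Finset.mem_powerset] at hA
      rw [Finset.mem_ssubsets]
      refine Finset.ssubset_of_subset_of_ssubset hA (Finset.ssubset_univ_iff.mpr ?_)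
      rintro rfl
      exact hMpos.ne' h1
    · intro A _ hA'
      exact hzero A fun h => hA' (Finset.mem_powerset.mpr h)

theorem sum_ssubsets_eq_sum_nonempty {M : Type*} [AddCommMonoid M] (S : Finset α)
    (f : Finset α → M) :
    ∑ T ∈ S.ssubsets, f T = ∑ B ∈ S.powerset with B.Nonempty, f (S \ B) := by
  refine Finset.sum_bij' (fun T _ => S \ T) (fun B _ => S \ B) ?_ ?_ ?_ ?_ ?_
  · intro T hT
    rw [Finset.mem_ssubsets] at hT
    simp only [Finset.mem_filter, Finset.mem_powerset]
    exact ⟨Finset.sdiff_subset, Finset.sdiff_nonempty.mpr hT.2⟩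
  · intro B hB
    simp only [Finset.mem_filter, Finset.mem_powerset] at hB
    rw [Finset.mem_ssubsets]
    exact Finset.sdiff_ssubset hB.1 hB.2
  · intro T hT
    rw [Finset.mem_ssubsets] at hT
    exact Finset.sdiff_sdiff_eq_self hT.1
  · intro B hB
    simp only [Finset.mem_filter, Finset.mem_powerset] at hB
    exact Finset.sdiff_sdiff_eq_self hB.1
  · intro T hT
    rw [Finset.mem_ssubsets] at hT
    rw [Finset.sdiff_sdiff_eq_self hT.1]

/-! ### Words -/

/-- The product of `c T p q` over the consecutive letters `p`, `q` of the word `p₀ :: l`, where `T`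
is the set of letters from `q` on. -/
def stepFrom {R : Type*} [CommMonoid R] (c : Finset α → α → α → R) : α → List α → R
  | _, [] => 1
  | p, q :: l => c (q :: l).toFinset p q * stepFrom c q l

/-- The product of `c T p q` over the consecutive letters `p`, `q` of a word, where `T` is the set
of letters from `q` on. -/
def stepOf {R : Type*} [CommMonoid R] (c : Finset α → α → α → R) : List α → R
  | [] => 1
  | p :: l => stepFrom c p l

theorem stepOf_ofFn {R : Type*} [CommMonoid R] (c : Finset α → α → α → R) {m : ℕ}
    (w : Fin (m + 1) → α) :
    stepOf c (List.ofFn w) =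
      ∏ j : Fin m, c ((Finset.Ici j.succ).image w) (w j.castSucc) (w j.succ) := by
  rw [List.ofFn_succ, stepOf]
  induction m with
  | zero => simp [stepFrom]
  | succ m ih =>
    rw [Fin.prod_univ_succ, List.ofFn_succ, stepFrom, ih fun j => w j.succ]
    congr 1
    · congr 1
      ext a
      rw [← List.ofFn_succ (f := fun i : Fin (m + 1) => w i.succ)]
      simp only [List.mem_toFinset, List.mem_ofFn, Finset.mem_image, Finset.mem_Ici]
      constructor
      · rintro ⟨i, rfl⟩
        exact ⟨i.succ, Fin.succ_le_succ_iff.mpr (Fin.zero_le _), rfl⟩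
      · rintro ⟨i, hi, rfl⟩
        induction i using Fin.cases with
        | zero => exact absurd hi (by simp)
        | succ i => exact ⟨i, rfl⟩
    · refine Finset.prod_congr rfl fun j _ => ?_
      congr 1
      ext a
      simp only [Finset.mem_image, Finset.mem_Ici]
      constructor
      · rintro ⟨i, hi, rfl⟩
        exact ⟨i.succ, Fin.succ_le_succ_iff.mpr hi, rfl⟩
      · rintro ⟨i, hi, rfl⟩
        induction i using Fin.cases with
        | zero => exact absurd hi (by simp)
        | succ i => exact ⟨i, Fin.succ_le_succ_iff.mp hi, rfl⟩

/-- A letter `q` together with larger letters forms one block with minimum `q`; the sum is reindexed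
by that block. -/
theorem sum_mul_sum_altChain_erase [LinearOrder α] (P : Finset α → Prop) [DecidablePred P]
    (S : Finset α) (c : α → ℝ) :
    ∑ q ∈ S, c q * ∑ B ∈ (S.erase q).powerset with ∀ b ∈ B, q < b, altChain P (S.erase q \ B) =
      ∑ B ∈ S.powerset, (∑ q ∈ B with ∀ b ∈ B, q ≤ b, c q) * altChain P (S \ B) := by
  simp_rw [Finset.sum_filter, Finset.sum_mul]
  rw [sum_powerset_sum_mem]
  refine Finset.sum_congr rfl fun q _ => ?_
  rw [Finset.mul_sum]
  refine Finset.sum_congr rfl fun B hB => ?_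
  rw [Finset.mem_powerset, Finset.subset_erase] at hB
  have h1 : (∀ b ∈ B, q < b) ↔ ∀ b ∈ insert q B, q ≤ b := by
    constructor
    · intro h b hb
      rcases Finset.mem_insert.mp hb with rfl | hb
      · exact le_rfl
      · exact (h b hb).le
    · intro h b hb
      exact lt_of_le_of_ne (h b (Finset.mem_insert_of_mem hb)) (by rintro rfl; exact hB.2 hb)
  have h2 : S.erase q \ B = S \ insert q B := by
    ext a; simp only [Finset.mem_sdiff, Finset.mem_insert, Finset.mem_erase]; tauto
  by_cases h : ∀ b ∈ B, q < b
  · rw [if_pos h, if_pos (h1.mp h), h2]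
  · rw [if_neg h, if_neg (fun h' => h (h1.mpr h'))]; simp

theorem sum_min_eq {M β : Type*} [AddCommMonoid M] [LinearOrder β] {B : Finset β} (hB : B.Nonempty)
    (c : β → M) : ∑ q ∈ B with ∀ b ∈ B, q ≤ b, c q = c (B.min' hB) := by
  have : B.filter (fun q => ∀ b ∈ B, q ≤ b) = {B.min' hB} := by
    ext q
    simp only [Finset.mem_filter, Finset.mem_singleton]
    constructor
    · rintro ⟨hq, h⟩
      exact le_antisymm (h _ (B.min'_mem hB)) (B.min'_le _ hq)
    · rintro rfl
      exact ⟨B.min'_mem hB, fun b hb => B.min'_le _ hb⟩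
  rw [this, Finset.sum_singleton]

/-- The two-sided cutoff attached to consecutive letters of a word. -/
noncomputable def cutoff [LinearOrder α] (P : Finset α → Prop) [DecidablePred P]
    (T : Finset α) (p q : α) : ℝ :=
  (if p < q then 1 else 0) - (if P T then 1 else 0)

/-- Expanding each cutoff means choosing, at each step of the word, an ascent or a cut weighted by
`-P`. Each block between cuts has exactly one increasing listing, so what remains is a sum over
chains of final unions. Here `B` is the rest of the block of `p`. -/
theorem sum_stepFrom_cutoff [LinearOrder α] (P : Finset α → Prop) [DecidablePred P]
    (p : α) (S : Finset α) :
    ∑ l ∈ words S, stepFrom (cutoff P) p l =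
      ∑ B ∈ S.powerset with ∀ b ∈ B, p < b, altChain P (S \ B) := by
  induction hc : S.card generalizing p S with
  | zero =>
    rw [Finset.card_eq_zero] at hc
    subst hc
    simp [words_empty, stepFrom, altChain_empty, Finset.filter_singleton]
  | succ k ih =>
    have hS : S.Nonempty := Finset.card_pos.mp (by omega)
    rw [sum_words_cons hS]
    have h1 : ∀ q ∈ S, ∑ l ∈ words (S.erase q), stepFrom (cutoff P) p (q :: l) =
        cutoff P S p q *
          ∑ B ∈ (S.erase q).powerset with ∀ b ∈ B, q < b, altChain P (S.erase q \ B) := by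
      intro q hq
      rw [← ih q (S.erase q) (by rw [Finset.card_erase_of_mem hq]; omega), Finset.mul_sum]
      refine Finset.sum_congr rfl fun l hl => ?_
      rw [stepFrom, List.toFinset_cons, (mem_words.mp hl).2, Finset.insert_erase hq]
    rw [Finset.sum_congr rfl h1, sum_mul_sum_altChain_erase]
    -- The inner sum picks the minimum of `B`. The empty set has none, so its term is added and
    -- subtracted; the subtracted part then cancels by the recursion for `altChain` at `S`.
    have h2 : ∀ B ∈ S.powerset, (∑ q ∈ B with ∀ b ∈ B, q ≤ b, cutoff P S p q) * altChain P (S \ B)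
        = (if ∀ b ∈ B, p < b then altChain P (S \ B) else 0) -
          ((if B.Nonempty then (if P S then altChain P (S \ B) else 0) else 0) +
            if B = ∅ then altChain P S else 0) := by
      intro B _
      rcases B.eq_empty_or_nonempty with rfl | hB
      · simp
      · rw [sum_min_eq hB, if_pos hB, if_neg hB.ne_empty]
        have h3 : (∀ b ∈ B, p < b) ↔ p < B.min' hB := (Finset.lt_min'_iff B hB).symm
        unfold cutoff
        by_cases ha : p < B.min' hB
        · rw [if_pos ha, if_pos (h3.mpr ha)]
          split_ifs <;> ring
        · rw [if_neg ha, if_neg (fun h => ha (h3.mp h))]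
          split_ifs <;> ring
    rw [Finset.sum_congr rfl h2, Finset.sum_sub_distrib, ← Finset.sum_filter,
      Finset.sum_add_distrib, ← Finset.sum_filter, Finset.sum_ite_eq' S.powerset ∅,
      if_pos (Finset.empty_mem_powerset S), altChain_eq P hS]
    split_ifs
    · rw [sum_ssubsets_eq_sum_nonempty]; ring
    · simp

theorem sum_stepOf_cutoff [LinearOrder α] (P : Finset α → Prop) [DecidablePred P]
    {S : Finset α} (hS : S.Nonempty) :
    ∑ l ∈ words S, stepOf (cutoff P) l = ∑ T ∈ S.ssubsets, altChain P T := by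
  rw [sum_words_cons hS]
  simp only [stepOf, sum_stepFrom_cutoff]
  have := sum_mul_sum_altChain_erase P S (fun _ => 1)
  simp only [one_mul] at this
  rw [this, sum_ssubsets_eq_sum_nonempty, Finset.sum_filter]
  refine Finset.sum_congr rfl fun B _ => ?_
  split_ifs with hB
  · rw [sum_min_eq hB, one_mul]
  · rw [Finset.not_nonempty_iff_eq_empty.mp hB]; simp

/-! ### Ordered set partitions -/

/-- The ordered set partitions of `S`, as lists of blocks. -/
def orderedPartitions (S : Finset α) : Finset (List (Finset α)) :=
  Finset.univ.biUnion fun π : Finpartition S => words π.parts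

theorem mem_orderedPartitions {S : Finset α} {l : List (Finset α)} :
    l ∈ orderedPartitions S ↔
      l.Pairwise Disjoint ∧ (∀ B ∈ l, B.Nonempty) ∧ l.toFinset.biUnion id = S := by
  unfold orderedPartitions
  simp only [Finset.mem_biUnion, Finset.mem_univ, true_and, mem_words]
  constructor
  · rintro ⟨π, hn, hl⟩
    refine ⟨hn.pairwise_of_forall_ne fun A hA B hB h => ?_, fun B hB => ?_, ?_⟩
    · exact π.disjoint (by rw [← hl]; simpa using hA) (by rw [← hl]; simpa using hB) h
    · exact π.nonempty_of_mem_parts (by rw [← hl]; simpa using hB)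
    · rw [hl, π.biUnion_parts]
  · rintro ⟨hp, hne, hu⟩
    refine ⟨⟨l.toFinset, ?_, ?_, ?_⟩, ?_, rfl⟩
    · rw [Finset.supIndep_iff_pairwiseDisjoint]
      intro A hA B hB h
      have hA' : A ∈ l := by simpa using hA
      have hB' : B ∈ l := by simpa using hB
      exact hp.forall hA' hB' h
    · rw [Finset.sup_eq_biUnion, hu]
    · intro h
      have := hne ⊥ (by simpa using h)
      simp at this
    · refine List.Pairwise.imp_of_mem (fun {A B} hA _ h => ?_) hp
      rintro rfl
      exact (hne A hA).ne_empty (disjoint_self.mp h)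

theorem sum_finpartition_words {M : Type*} [AddCommMonoid M] (S : Finset α)
    (f : List (Finset α) → M) :
    ∑ π : Finpartition S, ∑ l ∈ words π.parts, f l = ∑ l ∈ orderedPartitions S, f l := by
  unfold orderedPartitions
  rw [Finset.sum_biUnion]
  intro π _ π' _ hne
  refine Finset.disjoint_left.mpr fun l hl hl' => hne ?_
  exact Finpartition.ext (by rw [← (mem_words.mp hl).2, (mem_words.mp hl').2])

theorem cons_mem_orderedPartitions {S B : Finset α} {l : List (Finset α)} :
    B :: l ∈ orderedPartitions S ↔ (B ⊆ S ∧ B.Nonempty) ∧ l ∈ orderedPartitions (S \ B) := by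
  simp only [mem_orderedPartitions, List.pairwise_cons, List.mem_cons, List.toFinset_cons,
    Finset.biUnion_insert, id]
  constructor
  · rintro ⟨⟨h1, h2⟩, h3, rfl⟩
    refine ⟨⟨Finset.subset_union_left, h3 B (Or.inl rfl)⟩, h2, fun C hC => h3 C (Or.inr hC), ?_⟩
    rw [Finset.union_sdiff_cancel_left]
    rw [Finset.disjoint_biUnion_right]
    intro C hC
    exact h1 C (by simpa using hC)
  · rintro ⟨⟨h1, h2⟩, h3, h4, h5⟩
    refine ⟨⟨fun C hC => ?_, h3⟩, ?_, ?_⟩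
    · have : C ⊆ S \ B := by
        rw [← h5]
        exact Finset.subset_biUnion_of_mem id (by simpa using hC)
      exact Finset.disjoint_of_subset_right this Finset.disjoint_sdiff
    · rintro C (rfl | hC)
      · exact h2
      · exact h4 C hC
    · rw [h5, Finset.union_sdiff_of_subset h1]

theorem orderedPartitions_empty : orderedPartitions (∅ : Finset α) = {[]} := by
  ext l
  rw [Finset.mem_singleton]
  constructor
  · intro h
    match l, h with
    | [], _ => rfl
    | B :: l, h =>
      obtain ⟨⟨h1, h2⟩, -⟩ := cons_mem_orderedPartitions.mp h
      exact absurd (Finset.subset_empty.mp h1) h2.ne_empty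
  · rintro rfl
    simp [mem_orderedPartitions]

theorem sum_orderedPartitions_cons {M : Type*} [AddCommMonoid M] {S : Finset α} (hS : S.Nonempty)
    (f : List (Finset α) → M) :
    ∑ l ∈ orderedPartitions S, f l =
      ∑ B ∈ S.powerset with B.Nonempty, ∑ l ∈ orderedPartitions (S \ B), f (B :: l) := by
  rw [Finset.sum_sigma']
  symm
  refine Finset.sum_bij (fun x _ => x.1 :: x.2) ?_ ?_ ?_ ?_
  · rintro ⟨B, l⟩ h
    simp only [Finset.mem_sigma, Finset.mem_filter, Finset.mem_powerset] at h
    exact cons_mem_orderedPartitions.mpr h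
  · rintro ⟨B, l⟩ _ ⟨B', l'⟩ _ h
    simp only [List.cons.injEq] at h
    obtain ⟨rfl, rfl⟩ := h
    rfl
  · intro l hl
    match l, hl with
    | [], hl =>
      have := (mem_orderedPartitions.mp hl).2.2
      simp only [List.toFinset_nil, Finset.biUnion_empty] at this
      exact absurd this.symm hS.ne_empty
    | B :: l, hl =>
      refine ⟨⟨B, l⟩, ?_, rfl⟩
      simp only [Finset.mem_sigma, Finset.mem_filter, Finset.mem_powerset]
      exact cons_mem_orderedPartitions.mp hl
  · intros; rfl

/-- The alternating product of the indicators of `P` on the unions of the proper final segments of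
a list of blocks. -/
noncomputable def blockProd (P : Finset α → Prop) [DecidablePred P] : List (Finset α) → ℝ
  | [] => 1
  | _ :: l => (if l = [] then 1 else if P (l.toFinset.biUnion id) then -1 else 0) * blockProd P l

/-- The unions of proper final segments of an ordered partition form a chain of nonempty proper
subsets, and every such chain arises once. Removing the first block matches the recursion for
`altChain`. -/
theorem sum_blockProd (P : Finset α → Prop) [DecidablePred P] {S : Finset α} (hS : S.Nonempty) :
    ∑ l ∈ orderedPartitions S, blockProd P l = ∑ T ∈ S.ssubsets, altChain P T := by
  induction S using Finset.strongInduction with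
  | H S ih =>
    rw [sum_orderedPartitions_cons hS, sum_ssubsets_eq_sum_nonempty]
    refine Finset.sum_congr rfl fun B hB => ?_
    simp only [Finset.mem_filter, Finset.mem_powerset] at hB
    rcases (S \ B).eq_empty_or_nonempty with h | h
    · rw [h, orderedPartitions_empty, altChain_empty]
      simp [blockProd]
    · rw [altChain_eq P h, ← ih _ (Finset.sdiff_ssubset hB.1 hB.2) h]
      have : ∀ l ∈ orderedPartitions (S \ B), blockProd P (B :: l) =
          (if P (S \ B) then -1 else 0) * blockProd P l := by
        intro l hl
        have hu := (mem_orderedPartitions.mp hl).2.2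
        have hl0 : l ≠ [] := by
          rintro rfl
          simp only [List.toFinset_nil, Finset.biUnion_empty] at hu
          exact h.ne_empty hu.symm
        rw [blockProd, if_neg hl0, hu]
      rw [Finset.sum_congr rfl this, ← Finset.mul_sum]
      split_ifs <;> simp

theorem blockProd_ofFn (P : Finset α → Prop) [DecidablePred P] {m : ℕ}
    (b : Fin (m + 1) → Finset α) :
    blockProd P (List.ofFn b) =
      ∏ j : Fin m, if P ((Finset.Ici j.succ).biUnion b) then -1 else 0 := by
  induction m with
  | zero => simp [blockProd]
  | succ m ih =>
    rw [List.ofFn_succ, blockProd, ih, Fin.prod_univ_succ, if_neg (by simp [List.ofFn_succ])]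
    congr 2
    · congr 1
      ext a
      simp only [Finset.mem_biUnion, List.mem_toFinset, List.mem_ofFn, Finset.mem_Ici, id]
      constructor
      · rintro ⟨_, ⟨i, rfl⟩, h⟩
        exact ⟨i.succ, Fin.succ_le_succ_iff.mpr (Fin.zero_le _), h⟩
      · rintro ⟨i, hi, h⟩
        induction i using Fin.cases with
        | zero => exact absurd hi (by simp)
        | succ i => exact ⟨_, ⟨i, rfl⟩, h⟩
    · funext j
      congr 2
      ext a
      simp only [Finset.mem_biUnion, Finset.mem_Ici]
      constructor
      · rintro ⟨i, hi, h⟩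
        exact ⟨i.succ, Fin.succ_le_succ_iff.mpr hi, h⟩
      · rintro ⟨i, hi, h⟩
        induction i using Fin.cases with
        | zero => exact absurd hi (by simp)
        | succ i => exact ⟨i, Fin.succ_le_succ_iff.mp hi, h⟩

end AltChains

/-! ### Unimodular affine changes of variables -/

section Unimodular

theorem measurePreserving_mulVec_add {ι : Type*} [Fintype ι] [DecidableEq ι] {M : Matrix ι ι ℝ}
    (hM : M.det = 1) (c : ι → ℝ) :
    MeasurePreserving (fun v : ι → ℝ => M.mulVec v + c) volume volume := by
  have h1 : MeasurePreserving (Matrix.toLin' M) (volume : Measure (ι → ℝ)) volume := by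
    refine ⟨(LinearMap.continuous_of_finiteDimensional _).measurable, ?_⟩
    rw [Real.map_matrix_volume_pi_eq_smul_volume_pi (by rw [hM]; exact one_ne_zero), hM]
    simp
  exact (measurePreserving_add_right volume c).comp h1

theorem measurableEmbedding_mulVec_add {ι : Type*} [Fintype ι] [DecidableEq ι] {M : Matrix ι ι ℝ}
    (hM : M.det = 1) (c : ι → ℝ) :
    MeasurableEmbedding (fun v : ι → ℝ => M.mulVec v + c) := by
  have hinj : Function.Injective M.mulVec :=
    Matrix.mulVec_injective_iff_isUnit.mpr ((Matrix.isUnit_iff_isUnit_det M).mpr (by simp [hM]))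
  have h1 : MeasurableEmbedding (Matrix.toLin' M) :=
    (LinearMap.isClosedEmbedding_of_injective (f := Matrix.toLin' M)
      (LinearMap.ker_eq_bot.mpr hinj)).measurableEmbedding
  exact (measurableEmbedding_addRight c).comp h1

/-- The shear adding multiples of the coordinate `0` to the others. -/
def shear {m : ℕ} (α : Fin (m + 1) → ℝ) : Matrix (Fin (m + 1)) (Fin (m + 1)) ℝ :=
  fun j k => (if j = k then 1 else 0) + if k = 0 ∧ j ≠ 0 then α j else 0

theorem det_shear {m : ℕ} (α : Fin (m + 1) → ℝ) : (shear α).det = 1 := by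
  rw [Matrix.det_of_isLowerTriangular]
  · refine Finset.prod_eq_one fun j _ => ?_
    unfold shear
    rw [if_pos rfl, if_neg (fun h => h.2 h.1), add_zero]
  · intro j k h
    have h' : j < k := h
    unfold shear
    rw [if_neg h'.ne, if_neg (fun hk => by rw [hk.1] at h'; exact absurd h' (Fin.not_lt_zero j)),
      add_zero]

theorem shear_mulVec {m : ℕ} (α v : Fin (m + 1) → ℝ) (j : Fin (m + 1)) :
    (shear α).mulVec v j = v j + if j ≠ 0 then α j * v 0 else 0 := by
  unfold shear Matrix.mulVec dotProduct
  simp only [add_mul, ite_mul, one_mul, zero_mul, Finset.sum_add_distrib, Finset.sum_ite_eq,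
    Finset.mem_univ, if_true]
  congr 1
  rw [Finset.sum_eq_single 0]
  · simp
  · intro k _ hk; rw [if_neg (fun h => hk h.1)]
  · simp

/-- The matrix of the sums over final segments. -/
def finalSums (m : ℕ) : Matrix (Fin m) (Fin m) ℝ := fun j k => if j ≤ k then 1 else 0

theorem det_finalSums (m : ℕ) : (finalSums m).det = 1 := by
  rw [Matrix.det_of_isUpperTriangular]
  · exact Finset.prod_eq_one fun j _ => if_pos le_rfl
  · intro j k h
    exact if_neg (not_le.mpr h)

theorem finalSums_mulVec {m : ℕ} (v : Fin m → ℝ) (j : Fin m) :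
    (finalSums m).mulVec v j = ∑ k ∈ Finset.Ici j, v k := by
  unfold finalSums Matrix.mulVec dotProduct
  simp only [ite_mul, one_mul, zero_mul]
  rw [← Finset.sum_filter]
  congr 1
  ext k
  simp

theorem integral_head_mul_tail {m : ℕ} {𝕜 : Type*} [RCLike 𝕜] (φ : ℝ → 𝕜) (F : (Fin m → ℝ) → 𝕜) :
    ∫ t : Fin (m + 1) → ℝ, φ (t 0) * F (fun j => t j.succ) = (∫ r, φ r) * ∫ t, F t := by
  have h := volume_preserving_piFinSuccAbove (fun _ : Fin (m + 1) => ℝ) 0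
  rw [← integral_prod_mul, ← Measure.volume_eq_prod, ← h.integral_comp']
  rfl

end Unimodular

/-! ### The defect of a set -/

section Defect

/-- The defect of the set `S`: the centered sum of the `ξ i`, `i ∈ S`, minus half the product of the
sums of the `x i` over `S` and over its complement. -/
noncomputable def defect {n : ℕ} (x ξ : Fin n → ℝ) (S : Finset (Fin n)) : ℝ :=
  ∑ i ∈ S, ξ i - (∑ i ∈ S, x i) / (∑ i, x i) * ∑ i, ξ i -
    (∑ i ∈ S, x i) * (∑ i, x i - ∑ i ∈ S, x i) / 2

variable {n : ℕ} {x : Fin n → ℝ}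

theorem defect_empty (x ξ : Fin n → ℝ) : defect x ξ ∅ = 0 := by simp [defect]

theorem defect_univ (hx : ∑ i, x i ≠ 0) (ξ : Fin n → ℝ) : defect x ξ Finset.univ = 0 := by
  simp [defect, hx]

/-- The linear parts are modular. The quadratic part leaves the gap x(S \ T) · x(T \ S), which is
nonnegative. -/
theorem defect_supermodular (hx : ∀ j, 0 < x j) (ξ : Fin n → ℝ) (S T : Finset (Fin n)) :
    defect x ξ S + defect x ξ T ≤ defect x ξ (S ∪ T) + defect x ξ (S ∩ T) := by
  have h1 := Finset.sum_union_inter (s₁ := S) (s₂ := T) (f := x)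
  have h2 := Finset.sum_union_inter (s₁ := S) (s₂ := T) (f := ξ)
  have h3 : ∑ i ∈ S ∩ T, x i ≤ ∑ i ∈ S, x i :=
    Finset.sum_le_sum_of_subset_of_nonneg Finset.inter_subset_left fun i _ _ => (hx i).le
  have h4 : ∑ i ∈ S ∩ T, x i ≤ ∑ i ∈ T, x i :=
    Finset.sum_le_sum_of_subset_of_nonneg Finset.inter_subset_right fun i _ _ => (hx i).le
  unfold defect
  have h5 : ∑ i ∈ S ∪ T, x i = ∑ i ∈ S, x i + ∑ i ∈ T, x i - ∑ i ∈ S ∩ T, x i := by linarith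
  have h6 : ∑ i ∈ S ∪ T, ξ i = ∑ i ∈ S, ξ i + ∑ i ∈ T, ξ i - ∑ i ∈ S ∩ T, ξ i := by linarith
  rw [h5, h6]
  rw [← sub_nonneg]
  refine (mul_nonneg (sub_nonneg.mpr h3) (sub_nonneg.mpr h4)).trans_eq ?_
  ring

theorem measurable_defect (x : Fin n → ℝ) (S : Finset (Fin n)) :
    Measurable fun ξ => defect x ξ S := by
  unfold defect
  fun_prop

theorem defect_image (x ξ : Fin n → ℝ) (w : Equiv.Perm (Fin n)) (S : Finset (Fin n)) :
    defect x ξ (S.image w) = defect (fun j => x (w j)) (fun j => ξ (w j)) S := by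
  unfold defect
  rw [Finset.sum_image w.injective.injOn, Finset.sum_image w.injective.injOn, Equiv.sum_comp w ξ,
    Equiv.sum_comp w x]

/-- The total sum together with the defects of the proper final segments. -/
noncomputable def defectCoords {m : ℕ} (z η : Fin (m + 1) → ℝ) : Fin (m + 1) → ℝ :=
  Fin.cons (∑ j, η j) fun j : Fin m => defect z η (Finset.Ici j.succ)

/-- Sums over final segments form a unitriangular matrix whose row 0 is the total. Subtracting the
proportional shares of the total is a shear, and the quadratic part of the defect is a translation.
-/
theorem defectCoords_eq {m : ℕ} (z : Fin (m + 1) → ℝ) :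
    ∃ M : Matrix (Fin (m + 1)) (Fin (m + 1)) ℝ, M.det = 1 ∧ ∃ c, defectCoords z =
      fun η => M.mulVec η + c := by
  refine ⟨shear (fun j => -((∑ i ∈ Finset.Ici j, z i) / ∑ i, z i)) * finalSums (m + 1), ?_,
    Fin.cons 0 fun j : Fin m => -((∑ i ∈ Finset.Ici j.succ, z i) *
      (∑ i, z i - ∑ i ∈ Finset.Ici j.succ, z i) / 2), ?_⟩
  · rw [Matrix.det_mul, det_shear, det_finalSums, one_mul]
  · funext η j
    have h0 : Finset.Ici (0 : Fin (m + 1)) = Finset.univ := by ext; simp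
    rw [← Matrix.mulVec_mulVec, Pi.add_apply, shear_mulVec, finalSums_mulVec, finalSums_mulVec, h0]
    induction j using Fin.cases with
    | zero => simp [defectCoords, h0]
    | succ j =>
      simp only [defectCoords, Fin.cons_succ, ne_eq, Fin.succ_ne_zero, not_false_eq_true, if_true,
        defect]
      ring

theorem measurePreserving_defectCoords {m : ℕ} (z : Fin (m + 1) → ℝ) :
    MeasurePreserving (defectCoords z) volume volume := by
  obtain ⟨M, hM, c, h⟩ := defectCoords_eq z
  rw [h]
  exact measurePreserving_mulVec_add hM c

theorem measurableEmbedding_defectCoords {m : ℕ} (z : Fin (m + 1) → ℝ) :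
    MeasurableEmbedding (defectCoords z) := by
  obtain ⟨M, hM, c, h⟩ := defectCoords_eq z
  rw [h]
  exact measurableEmbedding_mulVec_add hM c

theorem sum_castSucc_sub_succ {m : ℕ} (Θ : Fin (m + 2) → ℝ) :
    ∑ j : Fin (m + 1), (Θ j.castSucc - Θ j.succ) = Θ 0 - Θ (Fin.last _) := by
  have h1 := Fin.sum_univ_succ Θ
  have h2 := Fin.sum_univ_castSucc Θ
  rw [Finset.sum_sub_distrib]
  linarith

/-- Okounkov's quadratic form, in the normalization matching standard Gaussian weights. -/
noncomputable def cyclicForm {m : ℕ} (z s : Fin (m + 1) → ℝ) : ℝ :=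
  ∑ j, ((s j - s (finRotate (m + 1) j)) ^ 2 / (2 * z j) +
    (s j + s (finRotate (m + 1) j)) * z j / 2)

/-- The bridge between the Gaussian exponent and Okounkov's form. Each `η j` is a difference of
consecutive defects plus `z j` times a midpoint value. Squaring gives the squared differences, and
summation by parts turns the cross terms into the linear terms of the form. The cubes measure the
error of the midpoint rule for a quadratic. -/
theorem sum_sq_div_eq {m : ℕ} {z : Fin (m + 1) → ℝ} (hz : ∀ j, 0 < z j) (η : Fin (m + 1) → ℝ) :
    ∑ j, η j ^ 2 / (2 * z j) = (∑ j, η j) ^ 2 / (2 * ∑ j, z j) +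
      ((∑ j, z j) ^ 3 - ∑ j, z j ^ 3) / 24 +
      cyclicForm z (Fin.cons 0 fun j : Fin m => defect z η (Finset.Ici j.succ)) := by
  have hX : 0 < ∑ j, z j := Finset.sum_pos (fun j _ => hz j) Finset.univ_nonempty
  -- Final segments including the empty one. The defect vanishes at both ends, so the cyclic
  -- successor of the last index, which is 0 with value 0, agrees with the empty segment.
  set J : Fin (m + 2) → Finset (Fin (m + 1)) := fun j => Finset.univ.filter (j ≤ ·.castSucc) with hJ
  have hJ0 : J 0 = Finset.univ := by ext; simp [hJ]
  have hJl : J (Fin.last _) = ∅ := by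
    ext k; simp [hJ]
  have hJc : ∀ j : Fin (m + 1), J j.castSucc = Finset.Ici j := by intro j; ext k; simp [hJ]
  have hJs : ∀ j : Fin (m + 1), J j.castSucc = insert j (J j.succ) := by
    intro j; ext k
    simp only [hJ, Finset.mem_filter, Finset.mem_univ, true_and, Finset.mem_insert,
      Fin.castSucc_le_castSucc_iff, Fin.succ_le_castSucc_iff]
    rw [le_iff_eq_or_lt, eq_comm]
  have hnot : ∀ j : Fin (m + 1), j ∉ J j.succ := by
    intro j; simp [hJ]
  set s : Fin (m + 1) → ℝ := Fin.cons 0 fun j : Fin m => defect z η (Finset.Ici j.succ) with hs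
  set T : Fin (m + 2) → ℝ := fun j => defect z η (J j) with hT
  have hT0 : T 0 = 0 := by simp only [hT, hJ0]; exact defect_univ hX.ne' η
  have hTl : T (Fin.last _) = 0 := by simp only [hT, hJl]; exact defect_empty _ _
  have hsT : ∀ j : Fin (m + 1), s j = T j.castSucc := by
    intro j
    induction j using Fin.cases with
    | zero => rw [Fin.castSucc_zero, hT0]; rfl
    | succ j => simp only [hs, hT, Fin.cons_succ, hJc]
  have hsT' : ∀ j : Fin (m + 1), s (finRotate (m + 1) j) = T j.succ := by
    intro j
    induction j using Fin.lastCases with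
    | last => rw [finRotate_last, Fin.succ_last, hTl]; rfl
    | cast j =>
      rw [finRotate_apply, Fin.coeSucc_eq_succ, hsT, Fin.succ_castSucc]
  set Z : Fin (m + 2) → ℝ := fun j => ∑ i ∈ J j, z i with hZ
  set A : Fin (m + 2) → ℝ := fun j => ∑ i ∈ J j, η i with hA
  set X := ∑ j, z j with hXd
  set r := ∑ j, η j with hr
  have hZ0 : Z 0 = X := by simp only [hZ, hJ0]; rfl
  have hZl : Z (Fin.last _) = 0 := by simp only [hZ, hJl]; simp
  have hZs : ∀ j : Fin (m + 1), z j = Z j.castSucc - Z j.succ := by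
    intro j; simp only [hZ]; rw [hJs, Finset.sum_insert (hnot j)]; ring
  have hAs : ∀ j : Fin (m + 1), η j = A j.castSucc - A j.succ := by
    intro j; simp only [hA]; rw [hJs, Finset.sum_insert (hnot j)]; ring
  have hTd : ∀ j, T j = A j - Z j / X * r - Z j * (X - Z j) / 2 := fun j => rfl
  -- A discrete primitive of everything in `η j ^ 2 / (2 * z j)` outside the cyclic form and the
  -- cubes; only its endpoint values survive.
  set Θ : Fin (m + 2) → ℝ := fun j => r / X * T j + (X / 2 - Z j) * T j +
    r ^ 2 / (2 * X ^ 2) * Z j + r / X * (Z j * (X - Z j) / 2) - (X / 2 - Z j) ^ 3 / 6 with hΘ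
  have hterm : ∀ j : Fin (m + 1), η j ^ 2 / (2 * z j) =
      (Θ j.castSucc - Θ j.succ) - z j ^ 3 / 24 +
        ((s j - s (finRotate (m + 1) j)) ^ 2 / (2 * z j) +
          (s j + s (finRotate (m + 1) j)) * z j / 2) := by
    intro j
    rw [hsT, hsT']
    have hd : η j = T j.castSucc - T j.succ + z j * (r / X + (X - Z j.castSucc - Z j.succ) / 2) := by
      rw [hAs, hTd, hTd, hZs]; ring
    have hz0 := (hz j).ne'
    rw [hd]
    have hexp : (T j.castSucc - T j.succ + z j * (r / X + (X - Z j.castSucc - Z j.succ) / 2)) ^ 2 /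
        (2 * z j) = (T j.castSucc - T j.succ) ^ 2 / (2 * z j) +
        (T j.castSucc - T j.succ) * (r / X + (X - Z j.castSucc - Z j.succ) / 2) +
        z j * (r / X + (X - Z j.castSucc - Z j.succ) / 2) ^ 2 / 2 := by
      field_simp
      ring
    rw [hexp]
    simp only [hΘ]
    generalize (T j.castSucc - T j.succ) ^ 2 / (2 * z j) = q
    rw [hZs]
    ring
  rw [Finset.sum_congr rfl fun j _ => hterm j, Finset.sum_add_distrib, Finset.sum_sub_distrib,
    sum_castSucc_sub_succ, ← Finset.sum_div]
  simp only [hΘ, hT0, hTl, hZ0, hZl]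
  unfold cyclicForm
  field_simp
  ring

end Defect

/-! ### Exponential sums over words -/

section WordSum

/-- The sum over all words of the chain weights times the exponential pairings. -/
noncomputable def wordSum {n : ℕ} (x : Fin n → ℝ) (v : Fin n → ℂ) : ℂ :=
  ∑ l ∈ words (Finset.univ : Finset (Fin n)), chainOf v l *
    pairProd (fun i j => Complex.exp (x i * x j * (v i - v j) / 2)) l

/-- The weight of two consecutive letters `p`, `q` of a word with `T` the set of letters from `q`
on. -/
noncomputable def coneWeight {n : ℕ} (x : Fin n → ℝ) (v : Fin n → ℂ) (T : Finset (Fin n))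
    (p q : Fin n) : ℂ :=
  Complex.exp (((∑ i ∈ T, x i) * (∑ i, x i - ∑ i ∈ T, x i) / 2 : ℝ) * (v p - v q)) * (v p - v q)⁻¹

theorem prod_map_exp {α : Type*} (l : List α) (f : α → ℂ) :
    (l.map fun i => Complex.exp (f i)).prod = Complex.exp (l.map f).sum := by
  induction l with
  | nil => simp
  | cons a l ih => simp [ih, Complex.exp_add]

theorem sum_map_mul_sub {α : Type*} (l : List α) (x v : α → ℂ) (a : ℂ) :
    (l.map fun i => x i * (a - v i)).sum = a * (l.map x).sum - (l.map fun i => x i * v i).sum := by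
  induction l with
  | nil => simp
  | cons b l ih => simp only [List.map_cons, List.sum_cons, ih]; ring

/-- Writing `v i - v j` as a sum of consecutive differences, the pair exponents collect at each cut
into x(T) times the weight of the complement of `T`. In the induction `Y` is the weight of the
letters before `p`; the last factor treats them as if they all sat at `p`. -/
theorem stepFrom_coneWeight {n : ℕ} (x : Fin n → ℝ) (v : Fin n → ℂ) (p : Fin n)
    (l : List (Fin n)) (hl : (p :: l).Nodup) (Y : ℝ)
    (hY : ∑ i, x i = Y + x p + (l.map x).sum) :
    stepFrom (coneWeight x v) p l = chainFrom v p l *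
      pairProd (fun i j => Complex.exp (x i * x j * (v i - v j) / 2)) (p :: l) *
      Complex.exp ((l.map fun i => x i * (v p - v i)).sum * (Y / 2)) := by
  induction l generalizing p Y with
  | nil => simp [stepFrom, chainFrom, pairProd]
  | cons q l ih =>
    have hl' : (q :: l).Nodup := (List.nodup_cons.mp hl).2
    rw [stepFrom, ih q hl' (Y + x p) (by rw [hY]; simp only [List.map_cons, List.sum_cons]; ring),
      chainFrom]
    conv_rhs => rw [pairProd]
    have hT : ∑ i ∈ (q :: l).toFinset, x i = ((q :: l).map x).sum :=
      List.sum_toFinset x hl'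
    unfold coneWeight
    rw [hT, hY, prod_map_exp]
    have hfac : ((q :: l).map fun j => (x p : ℂ) * x j * (v p - v j) / 2).sum =
        ((q :: l).map fun i => (x i : ℂ) * (v p - v i)).sum * (x p / 2) := by
      rw [← List.sum_map_mul_right]
      congr 2
      funext j
      ring
    rw [hfac]
    have hcast : ((((q :: l).map x).sum : ℝ) : ℂ) = ((q :: l).map fun i => (x i : ℂ)).sum := by
      rw [← Complex.ofRealHom_eq_coe, map_list_sum, List.map_map]
      rfl
    have hmain : ∀ E A B C : ℂ, ∀ P₁ P₂ Q : ℂ, Complex.exp A * Complex.exp B =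
        Complex.exp C * Complex.exp E →
        Complex.exp A * P₁ * (P₂ * Q * Complex.exp B) = P₁ * P₂ * (Complex.exp C * Q) *
          Complex.exp E := by
      intro E A B C P₁ P₂ Q h
      linear_combination P₁ * P₂ * Q * h
    apply hmain
    rw [← Complex.exp_add, ← Complex.exp_add]
    congr 1
    rw [sum_map_mul_sub, sum_map_mul_sub]
    have h1 : (((((q :: l).map x).sum * (Y + x p + ((q :: l).map x).sum - ((q :: l).map x).sum) / 2 :
        ℝ)) : ℂ) = ((q :: l).map fun i => (x i : ℂ)).sum * (Y + x p) / 2 := by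
      push_cast
      rw [hcast]
      ring
    rw [h1]
    simp only [List.map_cons, List.sum_cons]
    push_cast
    ring

theorem stepOf_coneWeight {n : ℕ} (x : Fin n → ℝ) (v : Fin n → ℂ) {l : List (Fin n)}
    (hl : l ∈ words (Finset.univ : Finset (Fin n))) :
    stepOf (coneWeight x v) l = chainOf v l *
      pairProd (fun i j => Complex.exp (x i * x j * (v i - v j) / 2)) l := by
  match l, hl with
  | [], _ => simp [stepOf, chainOf, pairProd]
  | p :: l, hl =>
    obtain ⟨hn, hf⟩ := mem_words.mp hl
    rw [stepOf, chainOf, stepFrom_coneWeight x v p l hn 0]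
    · simp
    · rw [← hf, List.sum_toFinset x hn]; simp

theorem wordSum_eq_sum_perm {n : ℕ} (x : Fin n → ℝ) (v : Fin n → ℂ) :
    wordSum x v = ∑ w : Equiv.Perm (Fin n), stepOf (coneWeight x v) (List.ofFn w) := by
  unfold wordSum
  rw [← Finset.sum_congr rfl fun l hl => stepOf_coneWeight x v hl,
    sum_words_perm Function.injective_id (S := Finset.univ) (by simp)]
  rfl

theorem buryakP_eq_wordSum {n : ℕ} (hn : 1 ≤ n) {x : Fin n → ℝ} (hx : ∀ j, 0 < x j)
    {a : Fin n → ℝ} (ha : Function.Injective fun j => a j / x j) :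
    buryakP n (fun j => Complex.I * (a j : ℂ)) (fun j => (x j : ℂ)) =
      (∏ j, (x j : ℂ))⁻¹ * wordSum x fun j => Complex.I * (a j : ℂ) / x j := by
  have hx' : ∀ j, (x j : ℂ) ≠ 0 := fun j => by exact_mod_cast (hx j).ne'
  rw [buryakP_eq_sum_words hn _ _ hx']
  · unfold wordSum
    congr 1
    refine Finset.sum_congr rfl fun l _ => ?_
    congr 2
    funext i j
    unfold expPair
    congr 1
    have := hx' i
    have := hx' j
    field_simp
  · intro i j h
    apply ha
    simp only [mul_div_assoc] at h
    have := mul_left_cancel₀ Complex.I_ne_zero h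
    exact_mod_cast this

end WordSum

/-! ### Fourier–Laplace transforms of cones -/

section Cones

/-- The indicator of t ≤ 0 and minus the indicator of t > 0 have the same transform, each on its own
half-plane of convergence. Hence the direction of a cone may be flipped without changing its weight.
-/
theorem integral_halfLine (b : Prop) [Decidable b] {a : ℂ} (h1 : b → 0 < a.re)
    (h2 : ¬ b → a.re < 0) :
    Integrable (fun t : ℝ => (((if b then 1 else 0) - (if 0 < t then 1 else 0) : ℝ) : ℂ) *
      Complex.exp (a * t)) ∧
    ∫ t : ℝ, (((if b then 1 else 0) - (if 0 < t then 1 else 0) : ℝ) : ℂ) * Complex.exp (a * t) =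
      a⁻¹ := by
  by_cases hb : b
  · have : (fun t : ℝ => (((if b then 1 else 0) - (if 0 < t then 1 else 0) : ℝ) : ℂ) *
        Complex.exp (a * t)) = (Set.Iic (0 : ℝ)).indicator fun t : ℝ => Complex.exp (a * t) := by
      funext t
      by_cases ht : 0 < t
      · rw [Set.indicator_of_notMem (by simpa using ht)]; simp [hb, ht]
      · rw [Set.indicator_of_mem (by simpa using ht)]; simp [hb, ht]
    rw [this, integrable_indicator_iff measurableSet_Iic, integral_indicator measurableSet_Iic]
    refine ⟨integrableOn_exp_mul_complex_Iic (h1 hb) 0, ?_⟩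
    rw [integral_exp_mul_complex_Iic (h1 hb)]
    simp
  · have : (fun t : ℝ => (((if b then 1 else 0) - (if 0 < t then 1 else 0) : ℝ) : ℂ) *
        Complex.exp (a * t)) = (Set.Ioi (0 : ℝ)).indicator fun t : ℝ => -Complex.exp (a * t) := by
      funext t
      by_cases ht : 0 < t
      · rw [Set.indicator_of_mem (by simpa using ht)]; simp [hb, ht]
      · rw [Set.indicator_of_notMem (by simpa using ht)]; simp [hb, ht]
    rw [this, integrable_indicator_iff measurableSet_Ioi, integral_indicator measurableSet_Ioi]
    refine ⟨(integrableOn_exp_mul_complex_Ioi (h2 hb) 0).neg, ?_⟩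
    rw [integral_neg, integral_exp_mul_complex_Ioi (h2 hb)]
    simp [neg_div]

/-- A Gaussian in the total sum times an exponential of the centered coordinates. -/
noncomputable def centeredKernel {n : ℕ} (x : Fin n → ℝ) (v : Fin n → ℂ) (ξ : Fin n → ℝ) : ℂ :=
  (Real.exp (-((∑ i, ξ i) ^ 2 / (2 * ∑ i, x i))) : ℂ) *
    Complex.exp (-∑ k, ((ξ k - x k / (∑ i, x i) * ∑ i, ξ i : ℝ) : ℂ) * v k)

/-- Summation by parts; the boundary term is the vanishing total of `a`. -/
theorem sum_mul_eq_sum_finalSums {m : ℕ} (a v : Fin (m + 1) → ℂ) (h : ∑ k, a k = 0) :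
    -∑ k, a k * v k =
      ∑ j : Fin m, (∑ k ∈ Finset.Ici j.succ, a k) * (v j.castSucc - v j.succ) := by
  have key : ∀ (m : ℕ) (a v : Fin (m + 1) → ℂ), ∑ k, a k * v k = (∑ k, a k) * v 0 -
      ∑ j : Fin m, (∑ k ∈ Finset.Ici j.succ, a k) * (v j.castSucc - v j.succ) := by
    intro m
    induction m with
    | zero => intro a v; simp
    | succ m ih =>
      intro a v
      have hI : ∀ j : Fin (m + 1), ∑ k ∈ Finset.Ici j.succ, a k =
          ∑ k ∈ Finset.Ici j, a k.succ := by
        intro j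
        rw [← Fin.map_succEmb_Ici, Finset.sum_map]
        rfl
      have h0 : Finset.Ici (0 : Fin (m + 1)) = Finset.univ := by ext; simp
      rw [Fin.sum_univ_succ, ih (fun k => a k.succ) (fun k => v k.succ), Fin.sum_univ_succ a]
      simp only [hI]
      rw [Fin.sum_univ_succ fun j : Fin (m + 1) =>
        (∑ k ∈ Finset.Ici j, a k.succ) * (v j.castSucc - v j.succ), h0]
      simp only [Fin.castSucc_zero, Fin.succ_castSucc]
      ring
  rw [key, h]
  ring

/-- For any order of the letters the kernel separates in the defect coordinates. The constants added
to the defects locate the vertex of the cone. -/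
theorem centeredKernel_perm {m : ℕ} {x : Fin (m + 1) → ℝ} (hX : ∑ i, x i ≠ 0)
    (v : Fin (m + 1) → ℂ) (w : Equiv.Perm (Fin (m + 1))) (ξ : Fin (m + 1) → ℝ) :
    centeredKernel x v ξ = (Real.exp (-((∑ i, ξ i) ^ 2 / (2 * ∑ i, x i))) : ℂ) *
      ∏ j : Fin m, Complex.exp (((defect (fun j => x (w j)) (fun j => ξ (w j)) (Finset.Ici j.succ) +
        (∑ i ∈ Finset.Ici j.succ, x (w i)) *
          (∑ i, x i - ∑ i ∈ Finset.Ici j.succ, x (w i)) / 2 : ℝ) : ℂ) *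
          (v (w j.castSucc) - v (w j.succ))) := by
  unfold centeredKernel
  rw [← Equiv.sum_comp w fun k => ((ξ k - x k / (∑ i, x i) * ∑ i, ξ i : ℝ) : ℂ) * v k,
    sum_mul_eq_sum_finalSums, Complex.exp_sum]
  · congr 1
    refine Finset.prod_congr rfl fun j _ => ?_
    congr 2
    rw [← Complex.ofReal_sum]
    congr 1
    unfold defect
    rw [Equiv.sum_comp w x, Equiv.sum_comp w ξ, Finset.sum_sub_distrib, ← Finset.sum_mul,
      ← Finset.sum_div]
    ring
  · rw [← Complex.ofReal_sum, Equiv.sum_comp w fun k => ξ k - x k / (∑ i, x i) * ∑ i, ξ i,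
      Finset.sum_sub_distrib, ← Finset.sum_mul, ← Finset.sum_div, div_self hX]
    simp

/-- In the defect coordinates of the order `w` the integrand is a product: a Gaussian in the total
and one half-line factor per step. Strictly decreasing real parts of `v` make the half-line chosen
by each cutoff the convergent one. -/
theorem cone_transform {m : ℕ} {x : Fin (m + 1) → ℝ} (hx : ∀ j, 0 < x j)
    {v : Fin (m + 1) → ℂ} (hv : StrictAnti fun j => (v j).re) (w : Equiv.Perm (Fin (m + 1))) :
    Integrable (fun ξ : Fin (m + 1) → ℝ =>
      ((stepOf (cutoff fun S => 0 < defect x ξ S) (List.ofFn w) : ℝ) : ℂ) * centeredKernel x v ξ) ∧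
    ∫ ξ : Fin (m + 1) → ℝ,
      ((stepOf (cutoff fun S => 0 < defect x ξ S) (List.ofFn w) : ℝ) : ℂ) * centeredKernel x v ξ =
      (Real.sqrt (2 * Real.pi * ∑ i, x i) : ℂ) * stepOf (coneWeight x v) (List.ofFn w) := by
  have hX : 0 < ∑ j, x j := Finset.sum_pos (fun j _ => hx j) Finset.univ_nonempty
  set z : Fin (m + 1) → ℝ := fun j => x (w j) with hz
  set d : Fin m → ℂ := fun j => v (w j.castSucc) - v (w j.succ) with hd
  set g : Fin m → ℝ := fun j => (∑ i ∈ Finset.Ici j.succ, x (w i)) *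
          (∑ i, x i - ∑ i ∈ Finset.Ici j.succ, x (w i)) / 2 with hg
  set F : Fin (m + 1) → ℝ → ℂ := Fin.cons
    (fun r => (Real.exp (-(r ^ 2 / (2 * ∑ i, x i))) : ℂ))
    (fun j t => Complex.exp (g j * d j) *
      ((((if w j.castSucc < w j.succ then 1 else 0) - (if 0 < t then 1 else 0) : ℝ) : ℂ) *
        Complex.exp (d j * t))) with hF
  have hre : ∀ j : Fin m, (w j.castSucc < w j.succ → 0 < (d j).re) ∧
      (¬ w j.castSucc < w j.succ → (d j).re < 0) := by
    intro j
    simp only [hd, Complex.sub_re]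
    constructor
    · intro h; have := hv h; simp only at this; linarith
    · intro h
      have hne : w j.succ ≠ w j.castSucc := fun h => (Fin.castSucc_lt_succ (i := j)).ne'
        (w.injective h)
      have := hv (lt_of_le_of_ne (not_lt.mp h) hne)
      simp only at this; linarith
  have hint : ∀ j, Integrable (F j) := by
    intro j
    induction j using Fin.cases with
    | zero =>
      simp only [hF, Fin.cons_zero]
      have := (integrable_exp_neg_mul_sq (b := 1 / (2 * ∑ i, x i)) (by positivity)).ofReal (𝕜 := ℂ)
      refine this.congr (Filter.Eventually.of_forall fun r => ?_)
      simp only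
      congr 2
      ring
    | succ j =>
      simp only [hF, Fin.cons_succ]
      exact (integral_halfLine _ (hre j).1 (hre j).2).1.const_mul _
  have hfun : (fun ξ : Fin (m + 1) → ℝ =>
      ((stepOf (cutoff fun S => 0 < defect x ξ S) (List.ofFn w) : ℝ) : ℂ) * centeredKernel x v ξ) =
      (fun t : Fin (m + 1) → ℝ => ∏ j, F j (t j)) ∘ defectCoords z ∘
        (MeasurableEquiv.piCongrLeft (fun _ : Fin (m + 1) => ℝ) w.symm) := by
    funext ξ
    have hη : (MeasurableEquiv.piCongrLeft (fun _ : Fin (m + 1) => ℝ) w.symm) ξ =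
        fun j => ξ (w j) := by
      funext j
      have := Equiv.piCongrLeft_apply_apply (P := fun _ : Fin (m + 1) => ℝ) w.symm ξ (w j)
      rw [Equiv.symm_apply_apply] at this
      exact this
    simp only [Function.comp]
    rw [hη, centeredKernel_perm hX.ne' v w ξ, stepOf_ofFn, Fin.prod_univ_succ]
    simp only [hF, Fin.cons_zero, Fin.cons_succ, defectCoords]
    rw [Equiv.sum_comp w ξ]
    push_cast
    rw [mul_left_comm, ← Finset.prod_mul_distrib]
    congr 1
    refine Finset.prod_congr rfl fun j _ => ?_
    rw [cutoff, defect_image]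
    simp only [hg, hd, hz]
    rw [add_mul, Complex.exp_add]
    push_cast
    ring_nf
  have hmp : MeasurePreserving (defectCoords z ∘
      (MeasurableEquiv.piCongrLeft (fun _ : Fin (m + 1) => ℝ) w.symm)) volume volume :=
    (measurePreserving_defectCoords z).comp
      (volume_measurePreserving_piCongrLeft (fun _ : Fin (m + 1) => ℝ) w.symm)
  have hme : MeasurableEmbedding (defectCoords z ∘
      (MeasurableEquiv.piCongrLeft (fun _ : Fin (m + 1) => ℝ) w.symm)) :=
    (measurableEmbedding_defectCoords z).comp (MeasurableEquiv.measurableEmbedding _)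
  rw [hfun]
  constructor
  · rw [hmp.integrable_comp_emb hme]
    exact Integrable.fintype_prod hint
  · refine (hmp.integral_comp hme (fun t : Fin (m + 1) → ℝ => ∏ j, F j (t j))).trans ?_
    rw [integral_fintype_prod_volume_eq_prod, Fin.prod_univ_succ, stepOf_ofFn]
    simp only [hF, Fin.cons_zero, Fin.cons_succ]
    congr 1
    · rw [integral_complex_ofReal]
      congr 1
      have := integral_gaussian (1 / (2 * ∑ i, x i))
      rw [show Real.pi / (1 / (2 * ∑ i, x i)) = 2 * Real.pi * ∑ i, x i by field_simp] at this
      rw [← this]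
      congr 1
      funext r
      congr 1
      ring
    · refine Finset.prod_congr rfl fun j _ => ?_
      rw [integral_const_mul, (integral_halfLine _ (hre j).1 (hre j).2).2, coneWeight,
        Finset.sum_image w.injective.injOn]

end Cones

/-! ### The zonotope and its Fourier transform -/

section Zonotope

/-- The set of all `ξ` for which no set has positive defect: a cylinder over a zonotope. -/
def zonotope {n : ℕ} (x : Fin n → ℝ) : Set (Fin n → ℝ) := {ξ | ∀ S, defect x ξ S ≤ 0}

variable {n : ℕ} {x : Fin n → ℝ}

theorem measurableSet_zonotope (x : Fin n → ℝ) : MeasurableSet (zonotope x) := by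
  have : zonotope x = ⋂ S, {ξ | defect x ξ S ≤ 0} := by ext; simp [zonotope]
  rw [this]
  exact MeasurableSet.iInter fun S => measurableSet_le (measurable_defect x S) measurable_const

theorem indicator_zonotope_eq (hn : 1 ≤ n) (hx : ∀ j, 0 < x j) (ξ : Fin n → ℝ) :
    (zonotope x).indicator (1 : (Fin n → ℝ) → ℝ) ξ =
      ∑ S ∈ (Finset.univ : Finset (Fin n)).ssubsets, altChain (fun S => 0 < defect x ξ S) S := by
  have : Nonempty (Fin n) := ⟨⟨0, hn⟩⟩
  have hX : 0 < ∑ j, x j := Finset.sum_pos (fun j _ => hx j) Finset.univ_nonempty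
  rw [sum_ssubsets_altChain _ (defect_supermodular hx ξ) (defect_empty x ξ) (defect_univ hX.ne' ξ)]
  by_cases h : ξ ∈ zonotope x
  · rw [Set.indicator_of_mem h]
    exact (if_pos h).symm
  · rw [Set.indicator_of_notMem h]
    exact (if_neg h).symm

theorem indicator_zonotope_eq_sum_perm (hn : 1 ≤ n) (hx : ∀ j, 0 < x j) (ξ : Fin n → ℝ) :
    (zonotope x).indicator (1 : (Fin n → ℝ) → ℝ) ξ =
      ∑ w : Equiv.Perm (Fin n), stepOf (cutoff fun S => 0 < defect x ξ S) (List.ofFn w) := by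
  have : Nonempty (Fin n) := ⟨⟨0, hn⟩⟩
  rw [indicator_zonotope_eq hn hx, ← sum_stepOf_cutoff _ Finset.univ_nonempty,
    sum_words_perm Function.injective_id (S := Finset.univ) (by simp)]
  rfl

theorem setIntegral_zonotope_of_strictAnti (hn : 1 ≤ n) (hx : ∀ j, 0 < x j) {v : Fin n → ℂ}
    (hv : StrictAnti fun j => (v j).re) :
    ∫ ξ in zonotope x, centeredKernel x v ξ =
      (Real.sqrt (2 * Real.pi * ∑ i, x i) : ℂ) * wordSum x v := by
  obtain ⟨m, rfl⟩ : ∃ m, n = m + 1 := ⟨n - 1, by omega⟩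
  rw [← integral_indicator (measurableSet_zonotope x), wordSum_eq_sum_perm, Finset.mul_sum,
    ← Finset.sum_congr rfl fun w _ => (cone_transform hx hv w).2,
    ← integral_finsetSum _ fun w _ => (cone_transform hx hv w).1]
  congr 1
  funext ξ
  rw [← Finset.sum_mul, ← Complex.ofReal_sum, ← indicator_zonotope_eq_sum_perm hn hx]
  by_cases h : ξ ∈ zonotope x
  · simp [Set.indicator_of_mem h]
  · simp [Set.indicator_of_notMem h]

/-- The inequality for a singleton bounds the centered coordinate above, that for its complement
bounds it below. -/
theorem abs_centered_le (hx : ∀ j, 0 < x j) {ξ : Fin n → ℝ} (hξ : ξ ∈ zonotope x) (k : Fin n) :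
    |ξ k - x k / (∑ i, x i) * ∑ i, ξ i| ≤ x k * (∑ i, x i - x k) / 2 := by
  have hX : 0 < ∑ j, x j := Finset.sum_pos (fun j _ => hx j) ⟨k, Finset.mem_univ k⟩
  have h1 := hξ {k}
  have h2 := hξ (Finset.univ.erase k)
  unfold defect at h1 h2
  rw [Finset.sum_singleton, Finset.sum_singleton] at h1
  rw [Finset.sum_erase_eq_sub (Finset.mem_univ k), Finset.sum_erase_eq_sub (Finset.mem_univ k)] at h2
  have h3 : (∑ i, x i - x k) / (∑ i, x i) * ∑ i, ξ i = ∑ i, ξ i - x k / (∑ i, x i) * ∑ i, ξ i := by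
    rw [sub_div, div_self hX.ne']; ring
  rw [h3] at h2
  rw [abs_le]
  constructor <;> linarith

theorem sum_sq_eq_centered (hx : ∀ j, 0 < x j) (ξ : Fin n → ℝ) :
    ∑ k, ξ k ^ 2 / (2 * x k) = (∑ i, ξ i) ^ 2 / (2 * ∑ i, x i) +
      ∑ k, (ξ k - x k / (∑ i, x i) * ∑ i, ξ i) ^ 2 / (2 * x k) := by
  rcases isEmpty_or_nonempty (Fin n) with h | h
  · simp
  have hX : 0 < ∑ j, x j := Finset.sum_pos (fun j _ => hx j) Finset.univ_nonempty
  set X := ∑ i, x i with hXd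
  set r := ∑ i, ξ i with hr
  have : ∀ k, (ξ k - x k / X * r) ^ 2 / (2 * x k) =
      ξ k ^ 2 / (2 * x k) - ξ k * (r / X) + x k * (r ^ 2 / (2 * X ^ 2)) := by
    intro k
    have := (hx k).ne'
    field_simp
    ring
  rw [Finset.sum_congr rfl fun k _ => this k, Finset.sum_add_distrib, Finset.sum_sub_distrib,
    ← Finset.sum_mul, ← Finset.sum_mul, ← hXd, ← hr]
  field_simp
  ring

theorem integrable_gaussian_pi (hx : ∀ j, 0 < x j) :
    Integrable fun ξ : Fin n → ℝ => ∏ k, Real.exp (-(ξ k ^ 2 / (2 * x k))) := by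
  refine Integrable.fintype_prod (f := fun k (t : ℝ) => Real.exp (-(t ^ 2 / (2 * x k)))) fun k => ?_
  have := integrable_exp_neg_mul_sq (b := 1 / (2 * x k)) (by have := hx k; positivity)
  refine this.congr (Filter.Eventually.of_forall fun r => ?_)
  simp only
  congr 1
  ring

/-- Centered coordinates are bounded on the zonotope, so the Gaussian in the total is there at most
a constant times the full Gaussian. -/
theorem integrableOn_zonotope (hx : ∀ j, 0 < x j) :
    IntegrableOn (fun ξ => Real.exp (-((∑ i, ξ i) ^ 2 / (2 * ∑ i, x i)))) (zonotope x) := by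
  refine Integrable.mono' (((integrable_gaussian_pi hx).const_mul
    (Real.exp (∑ k, (x k * (∑ i, x i - x k) / 2) ^ 2 / (2 * x k)))).integrableOn) ?_ ?_
  · exact (by fun_prop : Continuous _).aestronglyMeasurable
  · refine (ae_restrict_iff' (measurableSet_zonotope x)).mpr (Filter.Eventually.of_forall fun ξ hξ => ?_)
    rw [Real.norm_eq_abs, Real.abs_exp, ← Real.exp_sum, ← Real.exp_add, Real.exp_le_exp,
      Finset.sum_neg_distrib, sum_sq_eq_centered hx ξ]
    have : ∑ k, (ξ k - x k / (∑ i, x i) * ∑ i, ξ i) ^ 2 / (2 * x k) ≤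
        ∑ k, (x k * (∑ i, x i - x k) / 2) ^ 2 / (2 * x k) := by
      refine Finset.sum_le_sum fun k _ => ?_
      have := hx k
      refine div_le_div_of_nonneg_right ?_ (by positivity)
      exact sq_le_sq' (by linarith [(abs_le.mp (abs_centered_le hx hξ k)).1])
        (abs_le.mp (abs_centered_le hx hξ k)).2
    linarith

theorem continuousAt_chainFrom {α : Type*} {v : ℝ → α → ℂ} (hv : ∀ i, Continuous fun δ => v δ i)
    (h0 : Function.Injective (v 0)) (p : α) (l : List α) (hl : (p :: l).Nodup) :
    ContinuousAt (fun δ => chainFrom (v δ) p l) 0 := by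
  induction l generalizing p with
  | nil => exact continuousAt_const
  | cons q l ih =>
    simp only [chainFrom]
    have hpq : p ≠ q := fun h => (List.nodup_cons.mp hl).1 (by simp [h])
    refine ContinuousAt.mul (ContinuousAt.inv₀ ?_ ?_) (ih q (List.nodup_cons.mp hl).2)
    · exact ((hv p).sub (hv q)).continuousAt
    · exact sub_ne_zero.mpr fun h => hpq (h0 h)

theorem continuous_pairProd {α : Type*} {e : ℝ → α → α → ℂ}
    (he : ∀ i j, Continuous fun δ => e δ i j) (l : List α) :
    Continuous fun δ => pairProd (e δ) l := by
  induction l with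
  | nil => exact continuous_const
  | cons p l ih =>
    simp only [pairProd]
    refine Continuous.mul ?_ ih
    exact continuous_list_prod l fun i _ => he p i

theorem continuousAt_wordSum (x : Fin n → ℝ) {v : ℝ → Fin n → ℂ}
    (hv : ∀ i, Continuous fun δ => v δ i) (h0 : Function.Injective (v 0)) :
    ContinuousAt (fun δ => wordSum x (v δ)) 0 := by
  unfold wordSum
  refine tendsto_finsetSum _ fun l hl => ContinuousAt.mul ?_ ?_
  · match l, hl with
    | [], _ => exact continuousAt_const
    | p :: l, hl => exact continuousAt_chainFrom hv h0 p l (mem_words.mp hl).1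
  · refine (continuous_pairProd (fun i j => ?_) l).continuousAt
    have := hv i
    have := hv j
    fun_prop

/-- For imaginary `v` the individual cone integrals do not converge, but the total over the zonotope
does. The formula is the limit of the case of decreasing real parts, by dominated convergence on the
left and, as `v` is injective, continuity of the word sum away from its poles on the right. -/
theorem setIntegral_zonotope (hn : 1 ≤ n) (hx : ∀ j, 0 < x j) {v : Fin n → ℂ}
    (hv : ∀ j, (v j).re = 0) (hinj : Function.Injective v) :
    ∫ ξ in zonotope x, centeredKernel x v ξ =
      (Real.sqrt (2 * Real.pi * ∑ i, x i) : ℂ) * wordSum x v := by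
  -- Real parts `-δ k` are strictly decreasing in `k` for every δ > 0.
  set V : ℝ → Fin n → ℂ := fun δ k => v k - (δ * (k : ℕ) : ℝ) with hV
  have hV0 : V 0 = v := by funext k; simp [hV]
  have hVc : ∀ i, Continuous fun δ => V δ i := fun i => by simp only [hV]; fun_prop
  have hR : Filter.Tendsto (fun δ => (Real.sqrt (2 * Real.pi * ∑ i, x i) : ℂ) * wordSum x (V δ))
      (nhdsWithin 0 (Set.Ioi 0)) (nhds ((Real.sqrt (2 * Real.pi * ∑ i, x i) : ℂ) * wordSum x v)) := by
    refine Filter.Tendsto.const_mul _ ?_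
    have := continuousAt_wordSum x hVc (by rw [hV0]; exact hinj)
    have h2 := this.tendsto
    rw [hV0] at h2
    exact h2.mono_left nhdsWithin_le_nhds
  have hL : Filter.Tendsto (fun δ => ∫ ξ in zonotope x, centeredKernel x (V δ) ξ)
      (nhdsWithin 0 (Set.Ioi 0)) (nhds (∫ ξ in zonotope x, centeredKernel x v ξ)) := by
    refine tendsto_integral_filter_of_dominated_convergence
      (fun ξ => Real.exp (-((∑ i, ξ i) ^ 2 / (2 * ∑ i, x i))) *
        Real.exp (∑ k : Fin n, x k * (∑ i, x i - x k) / 2 * (k : ℕ))) ?_ ?_ ?_ ?_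
    · refine Filter.Eventually.of_forall fun δ => ?_
      refine Continuous.aestronglyMeasurable ?_
      unfold centeredKernel
      fun_prop
    · have h1 : ∀ᶠ δ : ℝ in nhdsWithin 0 (Set.Ioi 0), δ ∈ Set.Ioo (0 : ℝ) 1 :=
        Ioo_mem_nhdsGT one_pos
      filter_upwards [h1] with δ hδ
      refine (ae_restrict_iff' (measurableSet_zonotope x)).mpr
        (Filter.Eventually.of_forall fun ξ hξ => ?_)
      unfold centeredKernel
      rw [norm_mul, Complex.norm_real, Real.norm_eq_abs, Real.abs_exp, Complex.norm_exp]
      refine mul_le_mul_of_nonneg_left ?_ (Real.exp_pos _).le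
      rw [Real.exp_le_exp, Complex.neg_re, Complex.re_sum, ← Finset.sum_neg_distrib]
      refine Finset.sum_le_sum fun k _ => ?_
      rw [Complex.re_ofReal_mul]
      have h3 : (V δ k).re = -(δ * (k : ℕ)) := by
        simp only [hV]
        rw [Complex.sub_re, hv, Complex.ofReal_re]; ring
      rw [h3]
      have h4 := abs_centered_le hx hξ k
      have h5 := (abs_le.mp h4).2
      have h6 : (0 : ℝ) ≤ (k : ℕ) := Nat.cast_nonneg _
      have h7 : 0 ≤ x k * (∑ i, x i - x k) / 2 := (abs_nonneg _).trans h4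
      have h8 : δ * (k : ℕ) ≤ (k : ℕ) := mul_le_of_le_one_left h6 hδ.2.le
      calc -((ξ k - x k / (∑ i, x i) * ∑ i, ξ i) * -(δ * (k : ℕ)))
          = (ξ k - x k / (∑ i, x i) * ∑ i, ξ i) * (δ * (k : ℕ)) := by ring
        _ ≤ (x k * (∑ i, x i - x k) / 2) * (δ * (k : ℕ)) :=
          mul_le_mul_of_nonneg_right h5 (mul_nonneg hδ.1.le h6)
        _ ≤ _ := mul_le_mul_of_nonneg_left h8 h7
    · exact (integrableOn_zonotope hx).mul_const _
    · refine Filter.Eventually.of_forall fun ξ => ?_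
      have hc : Continuous fun δ => centeredKernel x (V δ) ξ := by
        unfold centeredKernel
        fun_prop
      have := hc.tendsto 0
      rw [hV0] at this
      exact this.mono_left nhdsWithin_le_nhds
  refine tendsto_nhds_unique hL (hR.congr' ?_)
  filter_upwards [self_mem_nhdsWithin] with δ hδ
  refine (setIntegral_zonotope_of_strictAnti hn hx ?_).symm
  intro i j hij
  have hij' : ((i : ℕ) : ℝ) < ((j : ℕ) : ℝ) := by exact_mod_cast hij
  simp only [hV, Complex.sub_re, hv, Complex.ofReal_re]
  have := mul_lt_mul_of_pos_left hij' (Set.mem_Ioi.mp hδ)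
  linarith

end Zonotope

/-! ### Buryak's integral -/

section Buryak

variable {n : ℕ} {x : Fin n → ℝ}

theorem ae_linearMap_ne_zero {ι : Type*} [Fintype ι] {f : (ι → ℝ) →ₗ[ℝ] ℝ} (hf : f ≠ 0) :
    ∀ᵐ a : ι → ℝ, f a ≠ 0 := by
  have h := Measure.addHaar_submodule (volume : Measure (ι → ℝ)) (LinearMap.ker f)
    (fun h => hf (LinearMap.ker_eq_top.mp h))
  rw [ae_iff]
  convert h using 2
  ext a
  simp

/-- Removes the poles of Buryak's integrand and, with `x = 1`, ties between coordinates in the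
orthant. -/
theorem ae_injective_div (hx : ∀ j, 0 < x j) :
    ∀ᵐ a : Fin n → ℝ, Function.Injective fun j => a j / x j := by
  have h : ∀ i j : Fin n, i ≠ j → ∀ᵐ a : Fin n → ℝ, a i / x i - a j / x j ≠ 0 := by
    intro i j hij
    have := ae_linearMap_ne_zero (f := (x i)⁻¹ • LinearMap.proj (R := ℝ) (φ := fun _ : Fin n => ℝ) i -
      (x j)⁻¹ • LinearMap.proj j) (fun h => by
        have h1 := LinearMap.congr_fun h (Pi.single i 1)
        simp [hij.symm, (hx i).ne'] at h1)
    filter_upwards [this] with a ha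
    simpa [div_eq_inv_mul] using ha
  have h' : ∀ᵐ a : Fin n → ℝ, ∀ i j : Fin n, i ≠ j → a i / x i - a j / x j ≠ 0 := by
    rw [ae_all_iff]; intro i
    rw [ae_all_iff]; intro j
    by_cases hij : i = j
    · exact Filter.Eventually.of_forall fun a h => absurd hij h
    · filter_upwards [h i j hij] with a ha _ using ha
  filter_upwards [h'] with a ha i j hij
  by_contra hne
  exact ha i j hne (sub_eq_zero.mpr hij)

theorem norm_centeredKernel_imag (x a ξ : Fin n → ℝ) :
    ‖centeredKernel x (fun j => Complex.I * (a j : ℂ) / x j) ξ‖ =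
      Real.exp (-((∑ i, ξ i) ^ 2 / (2 * ∑ i, x i))) := by
  have h : ∀ k, (((ξ k - x k / (∑ i, x i) * ∑ i, ξ i : ℝ) : ℂ) *
      (Complex.I * (a k : ℂ) / x k)).re = 0 := by
    intro k
    rw [Complex.re_ofReal_mul, mul_div_assoc, ← Complex.ofReal_div, Complex.re_mul_ofReal,
      Complex.I_re, zero_mul, mul_zero]
  unfold centeredKernel
  rw [norm_mul, Complex.norm_real, Real.norm_eq_abs, Real.abs_exp, Complex.norm_exp,
    Complex.neg_re, Complex.re_sum, Finset.sum_congr rfl fun k _ => h k]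
  simp

theorem integrable_prod_centeredKernel (hx : ∀ j, 0 < x j) :
    Integrable (fun p : (Fin n → ℝ) × (Fin n → ℝ) =>
      ((∏ j, Real.exp (-(p.1 j ^ 2 / (2 * x j))) : ℝ) : ℂ) *
        centeredKernel x (fun j => Complex.I * (p.1 j : ℂ) / x j) p.2)
      (volume.prod (volume.restrict (zonotope x))) := by
  refine Integrable.mono' ((integrable_gaussian_pi hx).mul_prod (integrableOn_zonotope hx)) ?_ ?_
  · refine Continuous.aestronglyMeasurable ?_
    unfold centeredKernel
    fun_prop
  · refine Filter.Eventually.of_forall fun p => ?_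
    rw [norm_mul, norm_centeredKernel_imag, Complex.norm_real, Real.norm_eq_abs,
      abs_of_nonneg (Finset.prod_nonneg fun j _ => (Real.exp_pos _).le)]

theorem buryakIntegrand_ae_eq (hn : 1 ≤ n) (hx : ∀ j, 0 < x j) :
    buryakIntegrand n x =ᵐ[volume] fun a =>
      ((∏ j, (x j : ℂ))⁻¹ * (Real.sqrt (2 * Real.pi * ∑ i, x i) : ℂ)⁻¹) *
      ∫ ξ in zonotope x, ((∏ j, Real.exp (-(a j ^ 2 / (2 * x j))) : ℝ) : ℂ) *
        centeredKernel x (fun j => Complex.I * (a j : ℂ) / x j) ξ := by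
  have : Nonempty (Fin n) := ⟨⟨0, hn⟩⟩
  have hX : 0 < ∑ j, x j := Finset.sum_pos (fun j _ => hx j) Finset.univ_nonempty
  have hs : (Real.sqrt (2 * Real.pi * ∑ i, x i) : ℂ) ≠ 0 := by
    exact_mod_cast (Real.sqrt_pos.mpr (by positivity)).ne'
  filter_upwards [ae_injective_div hx] with a ha
  rw [integral_const_mul, setIntegral_zonotope hn hx]
  · unfold buryakIntegrand
    rw [buryakP_eq_wordSum hn hx ha]
    field_simp
  · intro j
    rw [mul_div_assoc, ← Complex.ofReal_div, Complex.re_mul_ofReal, Complex.I_re, zero_mul]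
  · intro i j h
    apply ha
    simp only [mul_div_assoc] at h
    exact_mod_cast mul_left_cancel₀ Complex.I_ne_zero h

theorem integrable_buryakIntegrand (hn : 1 ≤ n) (hx : ∀ j, 0 < x j) :
    Integrable (buryakIntegrand n x) := by
  rw [integrable_congr (buryakIntegrand_ae_eq hn hx)]
  exact ((integrable_prod_centeredKernel hx).integral_prod_left).const_mul _

theorem integral_gaussian_mul_exp {y : ℝ} (hy : 0 < y) (c : ℝ) :
    ∫ a : ℝ, (Real.exp (-(a ^ 2 / (2 * y))) : ℂ) * Complex.exp (-(c * (Complex.I * a / y))) =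
      ((Real.sqrt (2 * Real.pi * y) * Real.exp (-(c ^ 2 / (2 * y))) : ℝ) : ℂ) := by
  have h := fourierIntegral_gaussian (b := ((1 / (2 * y) : ℝ) : ℂ))
    (by rw [Complex.ofReal_re]; positivity) ((-(c / y) : ℝ) : ℂ)
  have h1 : ((Real.pi : ℂ) / ((1 / (2 * y) : ℝ) : ℂ)) ^ (1 / 2 : ℂ) =
      (Real.sqrt (2 * Real.pi * y) : ℂ) := by
    rw [Real.sqrt_eq_rpow, ← Complex.ofReal_div, Complex.ofReal_cpow (by positivity)]
    congr 1
    · congr 1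
      field_simp
    · norm_num
  rw [h1] at h
  push_cast at h ⊢
  have hy' : (y : ℂ) ≠ 0 := by exact_mod_cast hy.ne'
  convert h using 1
  · congr 1
    funext a
    rw [mul_comm]
    congr 2 <;> field_simp
  · congr 2
    field_simp
    ring

/-- Integrating out `a` gives a Gaussian in the centered coordinates. Together with the Gaussian in
the total carried by the kernel, it recombines to the full Gaussian in ξ. -/
theorem integral_prod_centeredKernel (hx : ∀ j, 0 < x j) (ξ : Fin n → ℝ) :
    ∫ a : Fin n → ℝ, ((∏ j, Real.exp (-(a j ^ 2 / (2 * x j))) : ℝ) : ℂ) *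
        centeredKernel x (fun j => Complex.I * (a j : ℂ) / x j) ξ =
      (((∏ j, Real.sqrt (2 * Real.pi * x j)) * ∏ j, Real.exp (-(ξ j ^ 2 / (2 * x j))) : ℝ) : ℂ) := by
  have h : ∀ a : Fin n → ℝ, ((∏ j, Real.exp (-(a j ^ 2 / (2 * x j))) : ℝ) : ℂ) *
        centeredKernel x (fun j => Complex.I * (a j : ℂ) / x j) ξ =
      (Real.exp (-((∑ i, ξ i) ^ 2 / (2 * ∑ i, x i))) : ℂ) *
      ∏ j, ((Real.exp (-(a j ^ 2 / (2 * x j))) : ℂ) * Complex.exp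
        (-((ξ j - x j / (∑ i, x i) * ∑ i, ξ i : ℝ) * (Complex.I * a j / x j)))) := by
    intro a
    unfold centeredKernel
    rw [Finset.prod_mul_distrib, ← Complex.exp_sum, Finset.sum_neg_distrib, Complex.ofReal_prod]
    ring
  simp_rw [h]
  rw [integral_const_mul, integral_fintype_prod_volume_eq_prod (fun j (t : ℝ) =>
    (Real.exp (-(t ^ 2 / (2 * x j))) : ℂ) * Complex.exp
        (-((ξ j - x j / (∑ i, x i) * ∑ i, ξ i : ℝ) * (Complex.I * t / x j)))),
    Finset.prod_congr rfl fun j _ => integral_gaussian_mul_exp (hx j) _, ← Complex.ofReal_prod,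
    ← Complex.ofReal_mul]
  congr 1
  rw [Finset.prod_mul_distrib, ← Real.exp_sum, ← Real.exp_sum, mul_left_comm, ← Real.exp_add,
    Finset.sum_neg_distrib, Finset.sum_neg_distrib, sum_sq_eq_centered hx ξ]
  congr 2
  ring

theorem integral_buryakIntegrand (hn : 1 ≤ n) (hx : ∀ j, 0 < x j) :
    ∫ a, buryakIntegrand n x a = (((∏ j, x j)⁻¹ * (Real.sqrt (2 * Real.pi * ∑ i, x i))⁻¹ *
      (∏ j, Real.sqrt (2 * Real.pi * x j)) *
        ∫ ξ in zonotope x, ∏ j, Real.exp (-(ξ j ^ 2 / (2 * x j))) : ℝ) : ℂ) := by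
  rw [integral_congr_ae (buryakIntegrand_ae_eq hn hx), integral_const_mul,
    integral_integral_swap (integrable_prod_centeredKernel hx)]
  simp_rw [integral_prod_centeredKernel hx]
  rw [integral_complex_ofReal, integral_const_mul]
  push_cast
  ring

theorem buryakF_eq (hn : 1 ≤ n) (hx : ∀ j, 0 < x j) :
    buryakF n x = ((Real.exp ((∑ j, x j) ^ 3 / 24) /
      ((∑ j, x j) * Real.sqrt (2 * Real.pi * ∑ i, x i) * ∏ j, x j) *
        ∫ ξ in zonotope x, ∏ j, Real.exp (-(ξ j ^ 2 / (2 * x j))) : ℝ) : ℂ) := by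
  have : Nonempty (Fin n) := ⟨⟨0, hn⟩⟩
  have hX : 0 < ∑ j, x j := Finset.sum_pos (fun j _ => hx j) Finset.univ_nonempty
  have hs : Real.sqrt (2 * Real.pi * ∑ i, x i) ≠ 0 := (Real.sqrt_pos.mpr (by positivity)).ne'
  have hp : ∏ j, Real.sqrt (2 * Real.pi * x j) ≠ 0 := Finset.prod_ne_zero_iff.mpr fun j _ =>
    (Real.sqrt_pos.mpr (by have := hx j; positivity)).ne'
  have hp' : ∏ j, x j ≠ 0 := Finset.prod_ne_zero_iff.mpr fun j _ => (hx j).ne'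
  unfold buryakF
  rw [integral_buryakIntegrand hn hx, ← Complex.ofReal_mul]
  congr 1
  field_simp

end Buryak

/-! ### Gaussian measures and block sums -/

section GaussianBlocks

/-- The centered Gaussian weight with variances `x`. -/
noncomputable def gaussWeight {n : ℕ} (x ξ : Fin n → ℝ) : ℝ :=
  ∏ k, Real.exp (-(ξ k ^ 2 / (2 * x k)))

theorem gaussWeight_nonneg {n : ℕ} (x ξ : Fin n → ℝ) : 0 ≤ gaussWeight x ξ :=
  Finset.prod_nonneg fun _ _ => (Real.exp_pos _).le

theorem continuous_gaussWeight {n : ℕ} (x : Fin n → ℝ) : Continuous (gaussWeight x) := by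
  unfold gaussWeight
  fun_prop

/-- The normalization of the Gaussian weight. -/
noncomputable def gaussNorm {n : ℕ} (x : Fin n → ℝ) : ℝ := ∏ k, Real.sqrt (2 * Real.pi * x k)

theorem gaussNorm_pos {n : ℕ} {x : Fin n → ℝ} (hx : ∀ j, 0 < x j) : 0 < gaussNorm x :=
  Finset.prod_pos fun k _ => Real.sqrt_pos.mpr (by have := hx k; positivity)

/-- The product of the centered Gaussian measures with variances `x`. -/
noncomputable def gaussPi {n : ℕ} (x : Fin n → ℝ) : Measure (Fin n → ℝ) :=
  volume.withDensity fun ξ => ENNReal.ofReal ((gaussNorm x)⁻¹ * gaussWeight x ξ)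

theorem integral_gaussPi {n : ℕ} {x : Fin n → ℝ} (hx : ∀ j, 0 < x j) {E : Type*}
    [NormedAddCommGroup E] [NormedSpace ℝ E] (F : (Fin n → ℝ) → E) :
    ∫ ξ, F ξ ∂gaussPi x = (gaussNorm x)⁻¹ • ∫ ξ, gaussWeight x ξ • F ξ := by
  unfold gaussPi
  rw [integral_withDensity_eq_integral_toReal_smul, ← integral_smul]
  · congr 1
    funext ξ
    rw [ENNReal.toReal_ofReal (mul_nonneg (inv_nonneg.mpr (gaussNorm_pos hx).le)
      (gaussWeight_nonneg x ξ)), smul_smul]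
  · exact ((continuous_gaussWeight x).measurable.const_mul _).ennreal_ofReal
  · exact Filter.Eventually.of_forall fun ξ => ENNReal.ofReal_lt_top

theorem isFiniteMeasure_gaussPi {n : ℕ} {x : Fin n → ℝ} (hx : ∀ j, 0 < x j) :
    IsFiniteMeasure (gaussPi x) :=
  isFiniteMeasure_withDensity_ofReal ((integrable_gaussian_pi hx).const_mul _).2

theorem charFun_gaussPi {n : ℕ} {x : Fin n → ℝ} (hx : ∀ j, 0 < x j) (c : Fin n → ℝ) :
    ∫ ξ, Complex.exp ((∑ k, ξ k * c k : ℝ) * Complex.I) ∂gaussPi x =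
      ((∏ k, Real.exp (-(x k * c k ^ 2 / 2)) : ℝ) : ℂ) := by
  have h1 : ∀ ξ : Fin n → ℝ, gaussWeight x ξ • Complex.exp ((∑ k, ξ k * c k : ℝ) * Complex.I) =
      ∏ k, ((Real.exp (-(ξ k ^ 2 / (2 * x k))) : ℂ) *
        Complex.exp (-((-(x k * c k) : ℝ) * (Complex.I * ξ k / x k)))) := by
    intro ξ
    rw [Finset.prod_mul_distrib, ← Complex.exp_sum, ← Complex.ofReal_prod]
    change _ = ((gaussWeight x ξ : ℝ) : ℂ) * _
    rw [Complex.real_smul]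
    congr 2
    push_cast
    rw [Finset.sum_mul]
    refine Finset.sum_congr rfl fun k _ => ?_
    have : (x k : ℂ) ≠ 0 := by exact_mod_cast (hx k).ne'
    field_simp
  rw [integral_gaussPi hx]
  simp_rw [h1]
  rw [integral_fintype_prod_volume_eq_prod (fun k (t : ℝ) => (Real.exp (-(t ^ 2 / (2 * x k))) : ℂ) *
        Complex.exp (-((-(x k * c k) : ℝ) * (Complex.I * t / x k)))),
    Finset.prod_congr rfl fun k _ => integral_gaussian_mul_exp (hx k) _, ← Complex.ofReal_prod,
    Complex.real_smul, ← Complex.ofReal_mul, Finset.prod_mul_distrib]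
  congr 1
  change (gaussNorm x)⁻¹ * (gaussNorm x * _) = _
  rw [inv_mul_cancel_left₀ (gaussNorm_pos hx).ne']
  refine Finset.prod_congr rfl fun k _ => ?_
  congr 2
  have := (hx k).ne'
  field_simp

/-- The sums of the coordinates over the fibers of `β`. -/
def blockSums {n l : ℕ} (β : Fin n → Fin l) (ξ : Fin n → ℝ) (j : Fin l) : ℝ :=
  ∑ k with β k = j, ξ k

theorem measurable_blockSums {n l : ℕ} (β : Fin n → Fin l) : Measurable (blockSums β) := by
  unfold blockSums
  fun_prop

theorem blockSums_pos {n l : ℕ} {β : Fin n → Fin l} (hβ : Function.Surjective β)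
    {x : Fin n → ℝ} (hx : ∀ j, 0 < x j) (j : Fin l) : 0 < blockSums β x j := by
  obtain ⟨k, hk⟩ := hβ j
  exact Finset.sum_pos (fun k _ => hx k) ⟨k, by simp [hk]⟩

/-- Variances of independent Gaussians add; characteristic functions prove it. Surjectivity keeps
every block variance positive. -/
theorem map_gaussPi {n l : ℕ} {β : Fin n → Fin l} (hβ : Function.Surjective β)
    {x : Fin n → ℝ} (hx : ∀ j, 0 < x j) :
    (gaussPi x).map (blockSums β) = gaussPi (blockSums β x) := by
  have := isFiniteMeasure_gaussPi hx
  have := isFiniteMeasure_gaussPi (blockSums_pos hβ hx)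
  refine Measure.ext_of_charFunDual (funext fun L => ?_)
  obtain ⟨c, hL⟩ : ∃ c : Fin l → ℝ, ∀ η : Fin l → ℝ, L η = ∑ j, η j * c j := by
    refine ⟨fun j => L (Pi.single j 1), fun η => ?_⟩
    conv_lhs => rw [← Finset.univ_sum_single η, map_sum]
    refine Finset.sum_congr rfl fun j _ => ?_
    rw [← smul_eq_mul, ← map_smul, ← Pi.single_smul, smul_eq_mul, mul_one]
  have hL' : ∀ ξ : Fin n → ℝ, L (blockSums β ξ) = ∑ k, ξ k * c (β k) := by
    intro ξ
    rw [hL, ← Finset.sum_fiberwise Finset.univ β]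
    refine Finset.sum_congr rfl fun j _ => ?_
    unfold blockSums
    rw [Finset.sum_mul]
    refine Finset.sum_congr rfl fun k hk => ?_
    rw [(Finset.mem_filter.mp hk).2]
  rw [charFunDual_apply, charFunDual_apply, integral_map (measurable_blockSums β).aemeasurable
    (Continuous.aestronglyMeasurable (by fun_prop))]
  simp_rw [hL']
  simp_rw [hL]
  rw [charFun_gaussPi hx, charFun_gaussPi (blockSums_pos hβ hx)]
  congr 1
  rw [← Real.exp_sum, ← Real.exp_sum]
  congr 1
  rw [← Finset.sum_fiberwise Finset.univ β]
  refine Finset.sum_congr rfl fun j _ => ?_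
  unfold blockSums
  rw [Finset.sum_neg_distrib, Finset.sum_mul, Finset.sum_div]
  congr 1
  refine Finset.sum_congr rfl fun k hk => ?_
  rw [(Finset.mem_filter.mp hk).2]

theorem integral_gaussWeight_blockSums {n l : ℕ} {β : Fin n → Fin l} (hβ : Function.Surjective β)
    {x : Fin n → ℝ} (hx : ∀ j, 0 < x j) {F : (Fin l → ℝ) → ℝ} (hF : Measurable F) :
    ∫ ξ, gaussWeight x ξ * F (blockSums β ξ) = gaussNorm x * (gaussNorm (blockSums β x))⁻¹ *
      ∫ η, gaussWeight (blockSums β x) η * F η := by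
  have h1 := integral_gaussPi hx fun ξ => F (blockSums β ξ)
  have h2 := integral_gaussPi (blockSums_pos hβ hx) F
  rw [← map_gaussPi hβ hx, integral_map (measurable_blockSums β).aemeasurable
    hF.aestronglyMeasurable, h1] at h2
  simp only [smul_eq_mul] at h2
  rw [mul_assoc, ← h2, mul_inv_cancel_left₀ (gaussNorm_pos hx).ne']

theorem defect_blockSums {n l : ℕ} (β : Fin n → Fin l) (x ξ : Fin n → ℝ) (S : Finset (Fin l)) :
    defect x ξ (S.biUnion fun j => Finset.univ.filter (β · = j)) =
      defect (blockSums β x) (blockSums β ξ) S := by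
  have h : ∀ f : Fin n → ℝ, ∑ k ∈ S.biUnion (fun j => Finset.univ.filter (β · = j)), f k =
      ∑ j ∈ S, blockSums β f j := by
    intro f
    rw [Finset.sum_biUnion]
    · rfl
    · intro i _ j _ hij
      refine Finset.disjoint_left.mpr fun k hk hk' => hij ?_
      rw [← (Finset.mem_filter.mp hk).2, (Finset.mem_filter.mp hk').2]
  have h' : ∀ f : Fin n → ℝ, ∑ j, blockSums β f j = ∑ k, f k := fun f =>
    Finset.sum_fiberwise Finset.univ β f
  unfold defect
  rw [h, h, h', h']

end GaussianBlocks

/-! ### Orthant integrals -/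

section Orthant

/-- The integral over the positive orthant left over after normalizing the smallest variable. -/
noncomputable def orthantIntegral {m : ℕ} (z : Fin (m + 1) → ℝ) : ℝ :=
  ∫ t : Fin m → ℝ, (∏ j, if 0 < t j then 1 else 0) *
    Real.exp (-cyclicForm z (Fin.cons 0 t : Fin (m + 1) → ℝ))

/-- In defect coordinates the half-spaces become coordinate half-spaces and, by `sum_sq_div_eq`, the
total separates from the cyclic form. -/
theorem integral_gaussWeight_defect {m : ℕ} {z : Fin (m + 1) → ℝ} (hz : ∀ j, 0 < z j) :
    ∫ η, gaussWeight z η * ∏ j : Fin m, (if 0 < defect z η (Finset.Ici j.succ) then 1 else 0) =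
      Real.sqrt (2 * Real.pi * ∑ j, z j) * Real.exp (-(((∑ j, z j) ^ 3 - ∑ j, z j ^ 3) / 24)) *
        orthantIntegral z := by
  have hX : 0 < ∑ j, z j := Finset.sum_pos (fun j _ => hz j) Finset.univ_nonempty
  set C := Real.exp (-(((∑ j, z j) ^ 3 - ∑ j, z j ^ 3) / 24)) with hC
  set F : (Fin m → ℝ) → ℝ := fun t => (∏ j, if 0 < t j then 1 else 0) *
    Real.exp (-cyclicForm z (Fin.cons 0 t : Fin (m + 1) → ℝ)) with hF
  have hfun : ∀ η, gaussWeight z η *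
        ∏ j : Fin m, (if 0 < defect z η (Finset.Ici j.succ) then 1 else 0) =
      (fun t : Fin (m + 1) → ℝ => (fun r : ℝ => Real.exp (-(r ^ 2 / (2 * ∑ j, z j))) * C) (t 0) *
        F fun j => t j.succ) (defectCoords z η) := by
    intro η
    simp only [defectCoords, Fin.cons_zero, Fin.cons_succ, hF]
    unfold gaussWeight
    rw [← Real.exp_sum, Finset.sum_neg_distrib, sum_sq_div_eq hz, neg_add, neg_add, Real.exp_add,
      Real.exp_add, ← hC]
    ring
  rw [integral_congr_ae (Filter.Eventually.of_forall hfun)]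
  refine ((measurePreserving_defectCoords z).integral_comp
    (measurableEmbedding_defectCoords z) (fun t : Fin (m + 1) → ℝ =>
      (fun r : ℝ => Real.exp (-(r ^ 2 / (2 * ∑ j, z j))) * C) (t 0) * F fun j => t j.succ)).trans ?_
  rw [integral_head_mul_tail (fun r : ℝ => Real.exp (-(r ^ 2 / (2 * ∑ j, z j))) * C) F,
    integral_mul_const]
  unfold orthantIntegral
  congr 2
  have := integral_gaussian (1 / (2 * ∑ i, z i))
  rw [show Real.pi / (1 / (2 * ∑ i, z i)) = 2 * Real.pi * ∑ i, z i by field_simp] at this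
  rw [← this]
  congr 1
  funext r
  congr 1
  ring

/-- The contribution of a linear order of the blocks. -/
noncomputable def linearTerm : (l : ℕ) → (Fin l → ℝ) → ℝ
  | 0, _ => 0
  | _ + 1, z => Real.exp ((∑ j, z j ^ 3) / 24) / ((∑ j, z j) * gaussNorm z) * orthantIntegral z

/-- The integrand besides the weight depends only on block sums. The prefactor on the right is
common to all ordered partitions, which dictates the normalization of `linearTerm`. -/
theorem integral_gaussWeight_blockProd {n l : ℕ} (hl : 1 ≤ l) {β : Fin n → Fin l}
    (hβ : Function.Surjective β) {x : Fin n → ℝ} (hx : ∀ j, 0 < x j) :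
    ∫ ξ, gaussWeight x ξ * blockProd (fun S => 0 < defect x ξ S)
        (List.ofFn fun j => Finset.univ.filter (β · = j)) =
      (gaussNorm x * (∑ i, x i) * Real.sqrt (2 * Real.pi * ∑ i, x i) *
        Real.exp (-((∑ i, x i) ^ 3 / 24))) * ((-1) ^ (l + 1) * linearTerm l (blockSums β x)) := by
  obtain ⟨m, rfl⟩ : ∃ m, l = m + 1 := ⟨l - 1, by omega⟩
  have hz := blockSums_pos hβ hx
  set z := blockSums β x with hzd
  have hX : 0 < ∑ j, z j := Finset.sum_pos (fun j _ => hz j) Finset.univ_nonempty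
  have hXx : ∑ j, z j = ∑ i, x i := Finset.sum_fiberwise Finset.univ β x
  have hfun : ∀ ξ, gaussWeight x ξ * blockProd (fun S => 0 < defect x ξ S)
        (List.ofFn fun j => Finset.univ.filter (β · = j)) = (-1) ^ m * (gaussWeight x ξ *
      (fun η => ∏ j : Fin m, (if 0 < defect z η (Finset.Ici j.succ) then (1 : ℝ) else 0))
        (blockSums β ξ)) := by
    intro ξ
    rw [blockProd_ofFn, mul_left_comm]
    congr 1
    rw [show ((-1 : ℝ)) ^ m = ∏ _j : Fin m, (-1 : ℝ) by simp, ← Finset.prod_mul_distrib]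
    refine Finset.prod_congr rfl fun j _ => ?_
    rw [defect_blockSums]
    split_ifs <;> simp
  have hmeas : Measurable fun η : Fin (m + 1) → ℝ =>
      ∏ j : Fin m, (if 0 < defect z η (Finset.Ici j.succ) then (1 : ℝ) else 0) := by
    refine Finset.measurable_prod _ fun j _ => Measurable.ite ?_ measurable_const measurable_const
    exact measurableSet_lt measurable_const (measurable_defect z _)
  simp_rw [hfun]
  rw [integral_const_mul, integral_gaussWeight_blockSums hβ hx hmeas,
    integral_gaussWeight_defect hz, hXx]
  simp only [linearTerm]
  rw [← hzd, hXx, sub_div, neg_sub, sub_eq_add_neg, Real.exp_add]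
  rw [hXx] at hX
  have := (gaussNorm_pos hz).ne'
  field_simp
  ring

end Orthant

/-! ### The Gaussian measure of the zonotope as a sum over ordered set partitions -/

section Partitions

theorem integrable_gaussWeight_blockProd {n l : ℕ} (hl : 1 ≤ l) {x : Fin n → ℝ}
    (hx : ∀ j, 0 < x j) (b : Fin l → Finset (Fin n)) :
    Integrable fun ξ => gaussWeight x ξ *
      blockProd (fun S => 0 < defect x ξ S) (List.ofFn b) := by
  obtain ⟨m, rfl⟩ : ∃ m, l = m + 1 := ⟨l - 1, by omega⟩
  refine Integrable.mono' (integrable_gaussian_pi hx) ?_ ?_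
  · simp_rw [blockProd_ofFn]
    refine ((continuous_gaussWeight x).measurable.mul ?_).aestronglyMeasurable
    refine Finset.measurable_prod _ fun j _ => Measurable.ite ?_ measurable_const measurable_const
    exact measurableSet_lt measurable_const (measurable_defect x _)
  · refine Filter.Eventually.of_forall fun ξ => ?_
    rw [norm_mul, Real.norm_eq_abs, abs_of_nonneg (gaussWeight_nonneg x ξ), blockProd_ofFn]
    refine mul_le_of_le_one_right (gaussWeight_nonneg x ξ) ?_
    rw [norm_prod]
    refine Finset.prod_le_one (fun _ _ => norm_nonneg _) fun j _ => ?_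
    split_ifs <;> simp

theorem Finpartition.exists_index {n l : ℕ} (π : Finpartition (Finset.univ : Finset (Fin n)))
    (e : Fin l ≃ π.parts) :
    ∃ β : Fin n → Fin l, Function.Surjective β ∧
      ∀ j, (e j : Finset (Fin n)) = Finset.univ.filter (β · = j) := by
  have hmem : ∀ k, π.part k ∈ π.parts := fun k => π.part_mem.mpr (Finset.mem_univ k)
  have h : ∀ k j, e.symm ⟨π.part k, hmem k⟩ = j ↔ k ∈ (e j : Finset (Fin n)) := by
    intro k j
    rw [Equiv.symm_apply_eq, Subtype.ext_iff]
    exact π.part_eq_iff_mem (e j).2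
  refine ⟨fun k => e.symm ⟨π.part k, hmem k⟩, ?_, ?_⟩
  · intro j
    obtain ⟨k, hk⟩ := π.nonempty_of_mem_parts (e j).2
    exact ⟨k, (h k j).mpr hk⟩
  · intro j
    ext k
    rw [Finset.mem_filter, h]
    simp

theorem setIntegral_zonotope_gaussWeight {n : ℕ} (hn : 1 ≤ n) {x : Fin n → ℝ}
    (hx : ∀ j, 0 < x j) :
    ∫ ξ in zonotope x, gaussWeight x ξ =
      (gaussNorm x * (∑ i, x i) * Real.sqrt (2 * Real.pi * ∑ i, x i) *
        Real.exp (-((∑ i, x i) ^ 3 / 24))) *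
      ∑ π : Finpartition (Finset.univ : Finset (Fin n)), (-1) ^ (π.parts.card + 1) *
        ∑ σ : Equiv.Perm (Fin π.parts.card), linearTerm π.parts.card
          fun j => ∑ i ∈ (π.parts.equivFin.symm (σ j) : Finset (Fin n)), x i := by
  have : Nonempty (Fin n) := ⟨⟨0, hn⟩⟩
  have hcard : ∀ π : Finpartition (Finset.univ : Finset (Fin n)), 1 ≤ π.parts.card := fun π =>
    Finset.card_pos.mpr (π.parts_nonempty Finset.univ_nonempty.ne_empty)
  have hind : ∀ ξ, (zonotope x).indicator (gaussWeight x) ξ =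
      ∑ π : Finpartition (Finset.univ : Finset (Fin n)), ∑ σ : Equiv.Perm (Fin π.parts.card),
        gaussWeight x ξ * blockProd (fun S => 0 < defect x ξ S)
          (List.ofFn fun j => (π.parts.equivFin.symm (σ j) : Finset (Fin n))) := by
    intro ξ
    have h1 : (zonotope x).indicator (gaussWeight x) ξ = gaussWeight x ξ *
        (zonotope x).indicator (1 : (Fin n → ℝ) → ℝ) ξ := by
      by_cases h : ξ ∈ zonotope x
      · simp [Set.indicator_of_mem h]
      · simp [Set.indicator_of_notMem h]
    rw [h1, indicator_zonotope_eq hn hx, ← sum_blockProd _ Finset.univ_nonempty,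
      ← sum_finpartition_words, Finset.mul_sum]
    refine Finset.sum_congr rfl fun π _ => ?_
    rw [sum_words_perm (e := fun j => (π.parts.equivFin.symm j : Finset (Fin n)))
      (Subtype.val_injective.comp π.parts.equivFin.symm.injective), Finset.mul_sum]
    ext B
    simp only [Finset.mem_image, Finset.mem_univ, true_and]
    constructor
    · rintro ⟨j, rfl⟩; exact (π.parts.equivFin.symm j).2
    · intro hB; exact ⟨π.parts.equivFin ⟨B, hB⟩, by simp⟩
  set C := gaussNorm x * (∑ i, x i) * Real.sqrt (2 * Real.pi * ∑ i, x i) *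
    Real.exp (-((∑ i, x i) ^ 3 / 24))
  rw [← integral_indicator (measurableSet_zonotope x)]
  simp_rw [hind]
  have hint : ∀ (π : Finpartition (Finset.univ : Finset (Fin n)))
      (σ : Equiv.Perm (Fin π.parts.card)), Integrable fun ξ => gaussWeight x ξ *
        blockProd (fun S => 0 < defect x ξ S)
          (List.ofFn fun j => (π.parts.equivFin.symm (σ j) : Finset (Fin n))) :=
    fun π σ => integrable_gaussWeight_blockProd (hcard π) hx _
  rw [integral_finsetSum _ fun π _ => integrable_finsetSum _ fun σ _ => hint π σ, Finset.mul_sum]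
  refine Finset.sum_congr rfl fun π _ => ?_
  rw [integral_finsetSum _ fun σ _ => hint π σ, Finset.mul_sum, Finset.mul_sum]
  refine Finset.sum_congr rfl fun σ _ => ?_
  -- The ordered partition is encoded by the map sending each point to the position of its block.
  obtain ⟨β, hβ, hb⟩ := Finpartition.exists_index π (σ.trans π.parts.equivFin.symm)
  simp only [Equiv.trans_apply] at hb
  simp_rw [hb]
  exact integral_gaussWeight_blockProd (hcard π) hβ hx

end Partitions

/-! ### Okounkov's integral -/

section Okounkov

/-- The nonnegative orthant. -/
def orthant (n : ℕ) : Set (Fin n → ℝ) := {s | ∀ j, 0 ≤ s j}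

theorem orthant_eq_pi (n : ℕ) : orthant n = Set.univ.pi fun _ => Set.Ici 0 := by
  ext s; simp [orthant, Pi.le_def]

theorem measurableSet_orthant (n : ℕ) : MeasurableSet (orthant n) := by
  rw [orthant_eq_pi]
  exact MeasurableSet.univ_pi fun _ => measurableSet_Ici

/-- Dropping the squares and the successor terms leaves a product of decaying exponentials. The
constant `c` covers both normalizations, 4 and 2. -/
theorem integrableOn_orthant {n : ℕ} {c : ℝ} (hc : 0 < c) {y : Fin n → ℝ} (hy : ∀ j, 0 < y j) :
    IntegrableOn (fun s : Fin n → ℝ => Real.exp (-∑ j, ((s j - s (finRotate n j)) ^ 2 / (c * y j)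
      + (s j + s (finRotate n j)) * y j / 2))) (orthant n) := by
  have h1 : IntegrableOn (fun s : Fin n → ℝ => ∏ j, Real.exp (-(y j / 2) * s j)) (orthant n) := by
    rw [orthant_eq_pi]
    unfold IntegrableOn
    rw [volume_pi, Measure.restrict_pi_pi]
    refine Integrable.fintype_prod (f := fun j (t : ℝ) => Real.exp (-(y j / 2) * t)) fun j => ?_
    have h := integrableOn_exp_mul_Ioi (a := -(y j / 2)) (by have := hy j; linarith) 0
    exact (integrableOn_Ici_iff_integrableOn_Ioi).mpr h
  refine Integrable.mono' h1 ?_ ?_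
  · exact (by fun_prop : Continuous _).aestronglyMeasurable
  · refine (ae_restrict_iff' (measurableSet_orthant n)).mpr
      (Filter.Eventually.of_forall fun s hs => ?_)
    rw [Real.norm_eq_abs, Real.abs_exp, ← Real.exp_sum, Real.exp_le_exp, ← Finset.sum_neg_distrib]
    refine Finset.sum_le_sum fun j _ => ?_
    have h1 := hs j
    have h2 := hs (finRotate n j)
    have h3 := hy j
    have h4 : 0 ≤ (s j - s (finRotate n j)) ^ 2 / (c * y j) := by positivity
    have h5 : 0 ≤ s (finRotate n j) * y j := mul_nonneg h2 h3.le
    linarith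

theorem integrableOn_okounkovIntegrand {n : ℕ} {y : Fin n → ℝ} (hy : ∀ j, 0 < y j) :
    IntegrableOn (okounkovIntegrand n y) {s | ∀ j, 0 ≤ s j} :=
  integrableOn_orthant (c := 4) (by norm_num) hy

theorem integrableOn_cyclicForm {m : ℕ} {z : Fin (m + 1) → ℝ} (hz : ∀ j, 0 < z j) :
    IntegrableOn (fun s => Real.exp (-cyclicForm z s)) (orthant (m + 1)) :=
  integrableOn_orthant (c := 2) (by norm_num) hz

/-- The part of the orthant where the coordinate `c` is the strict minimum. -/
def minRegion {m : ℕ} (c : Fin (m + 1)) : Set (Fin (m + 1) → ℝ) :=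
  {s | 0 ≤ s c ∧ ∀ j, j ≠ c → s c < s j}

theorem measurableSet_minRegion {m : ℕ} (c : Fin (m + 1)) : MeasurableSet (minRegion c) := by
  have : minRegion c = {s | 0 ≤ s c} ∩ ⋂ j, ⋂ _ : j ≠ c, {s | s c < s j} := by
    ext s; simp [minRegion]
  rw [this]
  refine MeasurableSet.inter (measurableSet_le measurable_const (measurable_pi_apply c)) ?_
  exact MeasurableSet.iInter fun j => MeasurableSet.iInter fun _ =>
    measurableSet_lt (measurable_pi_apply c) (measurable_pi_apply j)

theorem minRegion_subset {m : ℕ} (c : Fin (m + 1)) : minRegion c ⊆ orthant (m + 1) := by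
  intro s hs j
  by_cases h : j = c
  · rw [h]; exact hs.1
  · exact hs.1.trans (hs.2 j h).le

/-- Almost every point has distinct coordinates, hence a unique strict minimum. -/
theorem setIntegral_orthant {m : ℕ} {f : (Fin (m + 1) → ℝ) → ℝ}
    (hf : IntegrableOn f (orthant (m + 1))) :
    ∫ s in orthant (m + 1), f s = ∑ c, ∫ s in minRegion c, f s := by
  have hae : ∀ᵐ s : Fin (m + 1) → ℝ, s ∈ ⋃ c, minRegion c ↔ s ∈ orthant (m + 1) := by
    filter_upwards [ae_injective_div (x := fun _ : Fin (m + 1) => 1) fun _ => one_pos] with s hs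
    constructor
    · intro h
      obtain ⟨c, hc⟩ := Set.mem_iUnion.mp h
      exact minRegion_subset c hc
    · intro h
      obtain ⟨c, -, hc⟩ := Finset.exists_min_image Finset.univ s Finset.univ_nonempty
      refine Set.mem_iUnion.mpr ⟨c, h c, fun j hj => ?_⟩
      refine lt_of_le_of_ne (hc j (Finset.mem_univ j)) fun he => hj ?_
      exact hs (by simp [he])
  rw [← setIntegral_congr_set (Filter.eventuallyEq_set.mpr hae),
    integral_iUnion_fintype (fun c => measurableSet_minRegion c)]
  · intro c c' hcc
    refine Set.disjoint_left.mpr fun s hs hs' => ?_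
    exact lt_asymm (hs.2 c' hcc.symm) (hs'.2 c hcc)
  · exact fun c => hf.mono_set (minRegion_subset c)

theorem cyclicForm_comp {m : ℕ} (z s : Fin (m + 1) → ℝ) (h : Equiv.Perm (Fin (m + 1)))
    (hh : ∀ j, h (finRotate (m + 1) j) = finRotate (m + 1) (h j)) :
    cyclicForm (fun j => z (h j)) (fun j => s (h j)) = cyclicForm z s := by
  unfold cyclicForm
  rw [← Equiv.sum_comp h fun j => (s j - s (finRotate (m + 1) j)) ^ 2 / (2 * z j) +
    (s j + s (finRotate (m + 1) j)) * z j / 2]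
  simp only [hh]

/-- Relabelling by a rotation moves the minimum to position 0 and preserves the cyclic form up to
rotating `z`. -/
theorem setIntegral_minRegion_perm {m : ℕ} (z : Fin (m + 1) → ℝ) (h : Equiv.Perm (Fin (m + 1)))
    (hh : ∀ j, h (finRotate (m + 1) j) = finRotate (m + 1) (h j)) :
    ∫ s in minRegion (h 0), Real.exp (-cyclicForm z s) =
      ∫ s in minRegion 0, Real.exp (-cyclicForm (fun j => z (h j)) s) := by
  have hmp := volume_measurePreserving_piCongrLeft (fun _ : Fin (m + 1) => ℝ) h.symm
  have hη : ∀ s, (MeasurableEquiv.piCongrLeft (fun _ : Fin (m + 1) => ℝ) h.symm) s =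
      fun j => s (h j) := by
    intro s
    funext j
    have := Equiv.piCongrLeft_apply_apply (P := fun _ : Fin (m + 1) => ℝ) h.symm s (h j)
    rw [Equiv.symm_apply_apply] at this
    exact this
  rw [← hmp.setIntegral_preimage_emb (MeasurableEquiv.measurableEmbedding _)
    (fun s => Real.exp (-cyclicForm (fun j => z (h j)) s)) (minRegion 0)]
  have hset : (MeasurableEquiv.piCongrLeft (fun _ : Fin (m + 1) => ℝ) h.symm) ⁻¹' minRegion 0 =
      minRegion (h 0) := by
    ext s
    rw [Set.mem_preimage, hη]
    simp only [minRegion, Set.mem_ofPred_eq]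
    refine and_congr_right fun _ => ⟨fun H j hj => ?_, fun H j hj => ?_⟩
    · have := H (h.symm j) (fun he => hj (by rw [← he, Equiv.apply_symm_apply]))
      rwa [Equiv.apply_symm_apply] at this
    · exact H (h j) fun he => hj (h.injective he)
  rw [hset]
  refine setIntegral_congr_fun (measurableSet_minRegion _) fun s _ => ?_
  simp only [hη, cyclicForm_comp z s h hh]

theorem cyclicForm_add {m : ℕ} (z s : Fin (m + 1) → ℝ) (r : ℝ) :
    cyclicForm z (fun j => s j + r) = cyclicForm z s + r * ∑ j, z j := by
  unfold cyclicForm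
  rw [Finset.mul_sum, ← Finset.sum_add_distrib]
  refine Finset.sum_congr rfl fun j _ => ?_
  rw [add_sub_add_right_eq_sub]
  ring

/-- Shifting all coordinates by the minimum `r` adds `r * ∑ j, z j` to the form. The integral over r
≥ 0 then contributes the inverse of that sum. -/
theorem setIntegral_minRegion_zero {m : ℕ} {z : Fin (m + 1) → ℝ} (hz : ∀ j, 0 < z j) :
    ∫ s in minRegion 0, Real.exp (-cyclicForm z s) = (∑ j, z j)⁻¹ * orthantIntegral z := by
  have hX : 0 < ∑ j, z j := Finset.sum_pos (fun j _ => hz j) Finset.univ_nonempty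
  set F : (Fin m → ℝ) → ℝ := fun t => (∏ j, if 0 < t j then 1 else 0) *
    Real.exp (-cyclicForm z (Fin.cons 0 t : Fin (m + 1) → ℝ)) with hF
  set φ : ℝ → ℝ := (Set.Ici 0).indicator fun r => Real.exp (-(∑ j, z j) * r) with hφ
  have hM := det_shear (m := m) fun _ => 1
  have hfun : ∀ t : Fin (m + 1) → ℝ, (minRegion 0).indicator (fun s => Real.exp (-cyclicForm z s))
      ((shear fun _ => 1).mulVec t + 0) = φ (t 0) * F fun j => t j.succ := by
    intro t
    have hs : (shear fun _ => 1).mulVec t + 0 =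
        fun j => (Fin.cons 0 fun j => t j.succ : Fin (m + 1) → ℝ) j + t 0 := by
      funext j
      rw [Pi.add_apply, shear_mulVec]
      induction j using Fin.cases with
      | zero => simp
      | succ j => simp
    have hmem : (shear fun _ => 1).mulVec t + 0 ∈ minRegion (m := m) 0 ↔
        t 0 ∈ Set.Ici (0 : ℝ) ∧ ∀ j : Fin m, 0 < t j.succ := by
      rw [hs]
      simp only [minRegion, Set.mem_ofPred_eq, Set.mem_Ici, Fin.cons_zero, zero_add]
      refine and_congr_right fun _ => ⟨fun H j => ?_, fun H j hj => ?_⟩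
      · have := H j.succ (Fin.succ_ne_zero j)
        rw [Fin.cons_succ] at this
        linarith
      · obtain ⟨i, rfl⟩ := Fin.exists_succ_eq.mpr hj
        rw [Fin.cons_succ]
        linarith [H i]
    by_cases h0 : t 0 ∈ Set.Ici (0 : ℝ)
    · by_cases h1 : ∀ j : Fin m, 0 < t j.succ
      · rw [Set.indicator_of_mem (hmem.mpr ⟨h0, h1⟩), hφ, Set.indicator_of_mem h0, hs,
          cyclicForm_add, hF]
        simp only [h1, if_true, Finset.prod_const_one, one_mul]
        rw [← Real.exp_add]
        congr 1
        ring
      · rw [Set.indicator_of_notMem fun h => h1 (hmem.mp h).2]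
        push Not at h1
        obtain ⟨j, hj⟩ := h1
        simp only [hF]
        rw [Finset.prod_eq_zero (Finset.mem_univ j) (if_neg (not_lt.mpr hj))]
        simp
    · rw [Set.indicator_of_notMem fun h => h0 (hmem.mp h).1, hφ, Set.indicator_of_notMem h0,
        zero_mul]
  rw [← integral_indicator (measurableSet_minRegion 0),
    ← (measurePreserving_mulVec_add hM 0).integral_comp (measurableEmbedding_mulVec_add hM 0)]
  simp_rw [hfun]
  rw [integral_head_mul_tail φ F, hφ, integral_indicator measurableSet_Ici,
    integral_Ici_eq_integral_Ioi, integral_exp_mul_Ioi (by linarith)]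
  simp only [mul_zero, Real.exp_zero]
  rw [neg_div_neg_eq, one_div]
  rfl

end Okounkov

/-! ### The cyclic sum and the comparison -/

section Comparison

theorem finRotate_pow_zero {m : ℕ} (k : ℕ) (hk : k < m + 1) :
    (finRotate (m + 1) ^ k) 0 = ⟨k, hk⟩ := by
  induction k with
  | zero => rfl
  | succ k ih =>
    rw [pow_succ', Equiv.Perm.mul_apply, ih (by omega), finRotate_of_lt (by omega)]

theorem commute_of_mem_rotations {m : ℕ} {h : Equiv.Perm (Fin (m + 1))}
    (hh : h ∈ rotations (m + 1)) (g : Equiv.Perm (Fin (m + 1))) (hg : g ∈ rotations (m + 1))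
    (j : Fin (m + 1)) : h (g j) = g (h j) := by
  obtain ⟨k, rfl⟩ := Subgroup.mem_zpowers_iff.mp hh
  obtain ⟨k', rfl⟩ := Subgroup.mem_zpowers_iff.mp hg
  rw [← Equiv.Perm.mul_apply, ← Equiv.Perm.mul_apply, ← zpow_add, ← zpow_add, add_comm k]

/-- Rotations act simply transitively: powers of the generator reach every index, and commutativity
lets the image of 0 determine the rest. -/
theorem bijective_rotations_apply_zero (m : ℕ) :
    Function.Bijective fun h : rotations (m + 1) => (h : Equiv.Perm (Fin (m + 1))) 0 := by
  have hpow : ∀ j : Fin (m + 1), (finRotate (m + 1) ^ (j : ℕ)) 0 = j := by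
    intro j; exact finRotate_pow_zero j j.2
  have hmem : ∀ k : ℕ, finRotate (m + 1) ^ k ∈ rotations (m + 1) := fun k =>
    Subgroup.npow_mem_zpowers _ k
  constructor
  · intro h h' he
    simp only at he
    apply Subtype.ext
    apply Equiv.ext
    intro j
    rw [← hpow j, commute_of_mem_rotations h.2 _ (hmem _), commute_of_mem_rotations h'.2 _ (hmem _),
      he]
  · intro c
    exact ⟨⟨_, hmem c⟩, hpow c⟩

theorem two_rpow_third_pos : (0 : ℝ) < (2 : ℝ) ^ ((1 : ℝ) / 3) := by positivity

theorem two_rpow_third_pow : ((2 : ℝ) ^ ((1 : ℝ) / 3)) ^ 3 = 2 := by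
  rw [← Real.rpow_natCast, ← Real.rpow_mul (by norm_num)]
  norm_num

/-- With c³ = 2, scaling `s` by c and dividing `z` by c turns the denominators 4 into 2 and leaves
the linear terms unchanged. -/
theorem okounkovIntegrand_scale {m : ℕ} (z s : Fin (m + 1) → ℝ) (hz : ∀ j, 0 < z j) :
    okounkovIntegrand (m + 1) (fun j => z j / (2 : ℝ) ^ ((1 : ℝ) / 3))
      ((2 : ℝ) ^ ((1 : ℝ) / 3) • s) = Real.exp (-cyclicForm z s) := by
  have h3 := two_rpow_third_pow
  have hpos := two_rpow_third_pos
  set c := (2 : ℝ) ^ ((1 : ℝ) / 3)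
  unfold okounkovIntegrand cyclicForm
  congr 2
  refine Finset.sum_congr rfl fun j _ => ?_
  simp only [Pi.smul_apply, smul_eq_mul]
  have := (hz j).ne'
  congr 1
  · rw [← mul_sub, mul_pow, div_eq_div_iff (by positivity) (by positivity)]
    field_simp
    linear_combination 2 * (s j - s (finRotate (m + 1) j)) ^ 2 * h3
  · field_simp

open scoped Pointwise in
theorem setIntegral_okounkovIntegrand {m : ℕ} {z : Fin (m + 1) → ℝ} (hz : ∀ j, 0 < z j) :
    ∫ s in {s : Fin (m + 1) → ℝ | ∀ j, 0 ≤ s j},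
        okounkovIntegrand (m + 1) (fun j => z j / (2 : ℝ) ^ ((1 : ℝ) / 3)) s =
      ((2 : ℝ) ^ ((1 : ℝ) / 3)) ^ (m + 1) *
        ∫ s in orthant (m + 1), Real.exp (-cyclicForm z s) := by
  have hpos := two_rpow_third_pos
  have h := Measure.setIntegral_comp_smul_of_pos (volume : Measure (Fin (m + 1) → ℝ))
    (okounkovIntegrand (m + 1) (fun j => z j / (2 : ℝ) ^ ((1 : ℝ) / 3))) (orthant (m + 1)) hpos
  simp_rw [okounkovIntegrand_scale z _ hz] at h
  have hset : (2 : ℝ) ^ ((1 : ℝ) / 3) • orthant (m + 1) = {s : Fin (m + 1) → ℝ | ∀ j, 0 ≤ s j} := by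
    ext s
    rw [Set.mem_smul_set_iff_inv_smul_mem₀ hpos.ne']
    simp only [orthant, Set.mem_ofPred_eq, Pi.smul_apply, smul_eq_mul]
    exact forall_congr' fun j => mul_nonneg_iff_of_pos_left (inv_pos.mpr hpos)
  rw [h, hset, Module.finrank_fin_fun, smul_eq_mul, mul_inv_cancel_left₀ (pow_pos hpos _).ne']

/-- The position of the smallest variable cuts the cycle open; there is one linear order per
rotation. -/
theorem okounkovE_eq {m : ℕ} {z : Fin (m + 1) → ℝ} (hz : ∀ j, 0 < z j)
    [Fintype (rotations (m + 1))] :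
    okounkovE (m + 1) (fun j => z j / (2 : ℝ) ^ ((1 : ℝ) / 3)) =
      ∑ h : rotations (m + 1), linearTerm (m + 1) fun j => z ((h : Equiv.Perm (Fin (m + 1))) j) := by
  have h3 := two_rpow_third_pow
  have hpos := two_rpow_third_pos
  unfold okounkovE
  rw [setIntegral_okounkovIntegrand hz, setIntegral_orthant (integrableOn_cyclicForm hz),
    ← (bijective_rotations_apply_zero m).sum_comp fun c =>
      ∫ s in minRegion c, Real.exp (-cyclicForm z s), Finset.mul_sum, Finset.mul_sum]
  refine Finset.sum_congr rfl fun h _ => ?_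
  rw [setIntegral_minRegion_perm z h fun j =>
      commute_of_mem_rotations h.2 _ (Subgroup.mem_zpowers _) j,
    setIntegral_minRegion_zero fun j => hz _]
  simp only [linearTerm]
  have e1 : ∀ f : ℝ → ℝ, ∑ j, f (z ((h : Equiv.Perm (Fin (m + 1))) j)) = ∑ j, f (z j) := fun f =>
    Equiv.sum_comp (h : Equiv.Perm (Fin (m + 1))) fun j => f (z j)
  have e2 : gaussNorm (fun j => z ((h : Equiv.Perm (Fin (m + 1))) j)) = gaussNorm z :=
    Equiv.prod_comp (h : Equiv.Perm (Fin (m + 1))) fun j => Real.sqrt (2 * Real.pi * z j)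
  rw [e1 fun t => t ^ 3, e1 fun t => t, e2]
  set c := (2 : ℝ) ^ ((1 : ℝ) / 3) with hc
  have e3 : (∑ j, (z j / c) ^ 3) / 12 = (∑ j, z j ^ 3) / 24 := by
    simp_rw [div_pow, h3]
    rw [← Finset.sum_div]
    ring
  -- Since 4 / c = 2 c², each root releases a factor c, which cancels the Jacobian of the rescaling.
  have e4 : ∏ j, Real.sqrt (4 * Real.pi * (z j / c)) = gaussNorm z * c ^ (m + 1) := by
    have : c ^ (m + 1) = ∏ _j : Fin (m + 1), c := by simp
    unfold gaussNorm
    rw [this, ← Finset.prod_mul_distrib]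
    refine Finset.prod_congr rfl fun j _ => ?_
    have hzj := hz j
    rw [← Real.sqrt_sq hpos.le, ← Real.sqrt_mul (by positivity), Real.sqrt_sq hpos.le]
    congr 1
    field_simp
    linear_combination -2 * h3
  rw [e3, e4]
  have hX : 0 < ∑ j, z j := Finset.sum_pos (fun j _ => hz j) Finset.univ_nonempty
  have := (gaussNorm_pos hz).ne'
  field_simp

/-- Each coset of the rotations contributes one linear term per element, so the sum over cosets
becomes a sum over all permutations. -/
theorem okounkovCyclic_eq {l : ℕ} (hl : 1 ≤ l) {z : Fin l → ℝ} (hz : ∀ j, 0 < z j) :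
    okounkovCyclic l (fun j => z j / (2 : ℝ) ^ ((1 : ℝ) / 3)) =
      ∑ σ : Equiv.Perm (Fin l), linearTerm l fun j => z (σ j) := by
  classical
  obtain ⟨m, rfl⟩ : ∃ m, l = m + 1 := ⟨l - 1, by omega⟩
  unfold okounkovCyclic
  rw [← Finset.sum_fiberwise Finset.univ
    (fun σ : Equiv.Perm (Fin (m + 1)) => (QuotientGroup.mk σ : _ ⧸ rotations (m + 1)))]
  refine Finset.sum_congr rfl fun q _ => ?_
  induction q using QuotientGroup.induction_on with
  | H σ =>
    change okounkovE (m + 1) (fun j => z (σ j) / (2 : ℝ) ^ ((1 : ℝ) / 3)) = _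
    rw [okounkovE_eq fun j => hz (σ j)]
    refine Finset.sum_bij (fun h _ => σ * h) ?_ ?_ ?_ ?_
    · intro h _
      rw [Finset.mem_filter]
      refine ⟨Finset.mem_univ _, ?_⟩
      exact (QuotientGroup.mk_mul_of_mem σ h.2)
    · intro h _ h' _ he
      exact Subtype.ext (mul_left_cancel he)
    · intro τ hτ
      refine ⟨⟨σ⁻¹ * τ, QuotientGroup.eq.mp (Finset.mem_filter.mp hτ).2.symm⟩, Finset.mem_univ _, ?_⟩
      simp
    · intro h _
      rfl

theorem okounkovG_eq {n : ℕ} {x : Fin n → ℝ} (hn : 1 ≤ n) (hx : ∀ j, 0 < x j) :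
    okounkovG n (fun j => x j / (2 : ℝ) ^ ((1 : ℝ) / 3)) =
      ∑ π : Finpartition (Finset.univ : Finset (Fin n)), (-1) ^ (π.parts.card + 1) *
        ∑ σ : Equiv.Perm (Fin π.parts.card), linearTerm π.parts.card
          fun j => ∑ i ∈ (π.parts.equivFin.symm (σ j) : Finset (Fin n)), x i := by
  have : Nonempty (Fin n) := ⟨⟨0, hn⟩⟩
  unfold okounkovG
  refine Finset.sum_congr rfl fun π _ => ?_
  simp_rw [← Finset.sum_div]
  rw [okounkovCyclic_eq]
  · exact Finset.card_pos.mpr (π.parts_nonempty Finset.univ_nonempty.ne_empty)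
  · intro j
    exact Finset.sum_pos (fun i _ => hx i)
      (π.nonempty_of_mem_parts (π.parts.equivFin.symm j).2)

end Comparison

/-- Besides the equality, the theorem states that all integrals entering the two formulas
converge absolutely. -/
theorem mainTheorem1 (n : ℕ) (hn : 1 ≤ n) (x : Fin n → ℝ) (hx : ∀ j, 0 < x j) :
    MeasureTheory.Integrable (buryakIntegrand n x) ∧
      (∀ (l : ℕ) (y : Fin l → ℝ), 1 ≤ l → (∀ j, 0 < y j) →
        MeasureTheory.IntegrableOn (okounkovIntegrand l y) {s | ∀ j, 0 ≤ s j}) ∧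
      buryakF n x = (okounkovF n x : ℂ) := by
  refine ⟨integrable_buryakIntegrand hn hx, fun l y _ hy => integrableOn_okounkovIntegrand hy, ?_⟩
  have : Nonempty (Fin n) := ⟨⟨0, hn⟩⟩
  have hX : 0 < ∑ j, x j := Finset.sum_pos (fun j _ => hx j) Finset.univ_nonempty
  rw [buryakF_eq hn hx]
  congr 1
  change _ * (∫ ξ in zonotope x, gaussWeight x ξ) = _
  rw [setIntegral_zonotope_gaussWeight hn hx, ← okounkovG_eq hn hx]
  unfold okounkovF
  have hs : Real.sqrt (2 * Real.pi * ∑ i, x i) ≠ 0 := (Real.sqrt_pos.mpr (by positivity)).ne'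
  have hp : ∏ j, Real.sqrt (x j) ≠ 0 := Finset.prod_ne_zero_iff.mpr fun j _ =>
    (Real.sqrt_pos.mpr (hx j)).ne'
  -- The Gaussian normalization supplies the power of 2π in Okounkov's prefactor; dividing by the
  -- product of the `x j` leaves one inverse square root of each.
  have e1 : gaussNorm x = (2 * Real.pi) ^ ((n : ℝ) / 2) * ∏ j, Real.sqrt (x j) := by
    unfold gaussNorm
    rw [Finset.prod_congr rfl fun j _ => Real.sqrt_mul (by positivity : (0 : ℝ) ≤ 2 * Real.pi) (x j),
      Finset.prod_mul_distrib, Finset.prod_const, Finset.card_univ, Fintype.card_fin,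
      Real.sqrt_eq_rpow, ← Real.rpow_natCast, ← Real.rpow_mul (by positivity)]
    congr 2
    ring
  have e2 : ∏ j, x j = (∏ j, Real.sqrt (x j)) * ∏ j, Real.sqrt (x j) := by
    rw [← Finset.prod_mul_distrib]
    exact Finset.prod_congr rfl fun j _ => (Real.mul_self_sqrt (hx j).le).symm
  rw [e1, e2, Real.exp_neg]
  have := (Real.exp_pos ((∑ i, x i) ^ 3 / 24)).ne'
  field_simp
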